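/- A group $G$ is of F-type if it admits a presentation \[G=\langle a_1,\dots,a_n\mid a_1^{e_1}=\dots=a_n^{e_n}=U(a_1,\dots,a_p)\,V(a_{p+1},\dots,a_n)=1\rangle,\] where $n\ge 2$, $1\le p\le n-1$, each $e_i$ is $0$ or at least $2$, and, with \[G_1=\langle a_1,\dots,a_p\mid a_1^{e_1}=\dots=a_p^{e_p}=1\rangle,\qquad G_2=\langle a_{p+1},\dots,a_n\mid a_{p+1}^{e_{p+1}}=\dots=a_n^{e_n}=1\rangle\] (free products of cyclic groups), $U$ is a cyclically reduced word in the free product $G_1$ representing an element of infinite order, and $V$ is a cyclically reduced word in the free product $G_2$ representing an element of infinite order; moreover, if $p=1$ then $U=a_1^m$ with $|m|\ge 2$, and if $p=n-1$ then $V=a_n^m$ with $|m|\ge 2$. Let $G$ be a group of F-type, given with such a presentation. Then there is a homomorphism $\rho\colon G\to \mathrm{PSL}(2,\mathbb{C})$ whose compositions with the canonical homomorphisms $G_1\to G$ and $G_2\to G$ (sending each generator $a_i$ to $a_i$) are both injective; that is, $G_1$ and $G_2$ embed in $G$ and $\rho|_{G_1}$ and $\rho|_{G_2}$ are faithful. If,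 further, $U$ is not a proper power in $G_1$ and $V$ is not a proper power in $G_2$ (that is, $U\ne W^k$ for all $W\in G_1$ and $k\ge 2$, and similarly for $V$ in $G_2$), then there is an injective homomorphism $G\to \mathrm{PSL}(2,\mathbb{C})$. -/

import Mathlib

open scoped MatrixGroups

/-- The free product of cyclic groups `⟨aᵢ (i ∈ ι) ∣ aᵢ ^ eᵢ = 1⟩`; the `i`-th factor is infinite
cyclic when `e i = 0` and has order `e i` when `e i ≥ 1`. -/
abbrev CyclicFreeProduct {ι : Type} (e : ι → ℕ) : Type :=
  PresentedGroup (Set.range fun i : ι => FreeGroup.of i ^ e i)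

/-- A list of syllables `(i₁, k₁), …, (iᵣ, kᵣ)` is read as the word `a_{i₁}^{k₁} ⋯ a_{iᵣ}^{kᵣ}`. -/
def wordValue {ι : Type} (w : List (ι × ℤ)) : FreeGroup ι :=
  (w.map fun s => FreeGroup.of s.1 ^ s.2).prod

/-- The element of the free product of cyclics that a word represents. -/
def wordElt {ι : Type} (e : ι → ℕ) (w : List (ι × ℤ)) : CyclicFreeProduct e :=
  PresentedGroup.mk _ (wordValue w)

/-- A word is cyclically reduced in the free product of the cyclic groups `⟨aᵢ ∣ aᵢ ^ eᵢ⟩`: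
every syllable is nontrivial in its factor, consecutive syllables lie in different factors, and,
if there are at least two syllables, the first and the last lie in different factors. -/
def IsCyclicallyReducedWord {ι : Type} (e : ι → ℕ) (w : List (ι × ℤ)) : Prop :=
  (∀ s ∈ w, ¬ (e s.1 : ℤ) ∣ s.2) ∧
  w.IsChain (fun s t => s.1 ≠ t.1) ∧
  (2 ≤ w.length → w.head?.map Prod.fst ≠ w.getLast?.map Prod.fst)

/-- `g` is a proper power in `H`: `g = h ^ k` for some `h ∈ H` and some `k ≥ 2`. -/
def IsProperPower {H : Type*} [Group H] (g : H) : Prop :=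
  ∃ (h : H) (k : ℕ), 2 ≤ k ∧ h ^ k = g

/-- The data of an F-type presentation
`⟨a₁, …, aₙ ∣ a₁ ^ e₁ = ⋯ = aₙ ^ eₙ = U(a₁, …, a_p) V(a_{p+1}, …, aₙ) = 1⟩`.
Here `q = n - p`, the generators `a₁, …, a_p` (with exponents `e`) are indexed by `Fin p`, and
`a_{p+1}, …, aₙ` (with exponents `f`) by `Fin q`. -/
structure FTypePresentation where
  p : ℕ
  q : ℕ
  one_le_p : 1 ≤ p
  one_le_q : 1 ≤ q
  e : Fin p → ℕ
  f : Fin q → ℕ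
  e_cond : ∀ i, e i = 0 ∨ 2 ≤ e i
  f_cond : ∀ j, f j = 0 ∨ 2 ≤ f j
  U : List (Fin p × ℤ)
  V : List (Fin q × ℤ)
  U_reduced : IsCyclicallyReducedWord e U
  V_reduced : IsCyclicallyReducedWord f V
  U_infinite_order : ¬ IsOfFinOrder (wordElt e U)
  V_infinite_order : ¬ IsOfFinOrder (wordElt f V)
  U_of_p_eq_one : p = 1 → ∃ (i : Fin p) (m : ℤ), 2 ≤ |m| ∧ U = [(i, m)]
  V_of_q_eq_one : q = 1 → ∃ (j : Fin q) (m : ℤ), 2 ≤ |m| ∧ V = [(j, m)]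

namespace FTypePresentation

/-- The factor `G₁ = ⟨a₁, …, a_p ∣ a₁ ^ e₁ = ⋯ = a_p ^ e_p = 1⟩`. -/
abbrev G₁ (P : FTypePresentation) : Type := CyclicFreeProduct P.e

/-- The factor `G₂ = ⟨a_{p+1}, …, aₙ ∣ a_{p+1} ^ e_{p+1} = ⋯ = aₙ ^ eₙ = 1⟩`. -/
abbrev G₂ (P : FTypePresentation) : Type := CyclicFreeProduct P.f

/-- The relators `aᵢ ^ eᵢ` and `U V`. -/
def rels (P : FTypePresentation) : Set (FreeGroup (Fin P.p ⊕ Fin P.q)) :=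
  (Set.range fun i => FreeGroup.of i ^ Sum.elim P.e P.f i) ∪
    {FreeGroup.map Sum.inl (wordValue P.U) * FreeGroup.map Sum.inr (wordValue P.V)}

/-- The presented group. -/
abbrev Grp (P : FTypePresentation) : Type := PresentedGroup P.rels

/-- The canonical homomorphism `G₁ → G`, sending generators to generators. -/
def incl₁ (P : FTypePresentation) : P.G₁ →* P.Grp :=
  PresentedGroup.map (FreeGroup.map Sum.inl) (by
    rintro _ ⟨i, rfl⟩
    exact Or.inl ⟨Sum.inl i, by simp⟩)

/-- The canonical homomorphism `G₂ → G`, sending generators to generators. -/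
def incl₂ (P : FTypePresentation) : P.G₂ →* P.Grp :=
  PresentedGroup.map (FreeGroup.map Sum.inr) (by
    rintro _ ⟨j, rfl⟩
    exact Or.inl ⟨Sum.inr j, by simp⟩)

end FTypePresentation

/-! Send each generator to a matrix over `ℂ[X]` with prescribed eigenvalues and fixed points `x i`,
`x i + 2 / X`. As `X → ∞` the two fixed points collide, so each nontrivial syllable has a rank one
leading coefficient. These do not cancel along a reduced word (`exists_hasLead_polyRep`), so a
cyclically reduced word with at least two syllables has nonconstant trace. Each nontrivial element
therefore has trace `±2` at only finitely many values of `X`, and all but countably many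
specializations are generic (`IsGenericRep`); in particular they are faithful into `PSL(2, ℂ)`.

The trace of `U` takes all but countably many values on generic representations, and so does that of
`V` (`exists_isGenericRep`). Choose a common value other than `±2`, conjugate `U` and `V` to inverse
diagonal matrices, and glue: this represents `G` faithfully on both factors.

For the second claim, conjugate the second representation by `diag(s, s⁻¹)`, which respects the
gluing. An element outside `⟨U⟩` or `⟨V⟩` has nonzero off-diagonal entries: otherwise its commutator
with `U` or `V` has trace 2, hence is trivial, and centralizers are cyclic
(`exists_forall_commute_mem_zpowers`). An alternating product of such elements is then noncentral
for all but finitely many `s` (`finite_pairProd_mem_center`). There are countably many such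
products, so some `s` works for all; every other element is conjugate into a factor
(`isConj_pairProd`). -/

open Polynomial

/-! ### Lifts to `SL(2)` of projective representations. -/

section ProjectiveRepresentations

theorem eq_one_or_neg_one_of_mem_center {R : Type*} [CommRing R] [IsDomain R] {M : SL(2, R)}
    (hM : M ∈ Subgroup.center SL(2, R)) : M = 1 ∨ M = -1 := by
  obtain ⟨r, hr, h⟩ := Matrix.SpecialLinearGroup.mem_center_iff.1 hM
  rw [Fintype.card_fin, sq_eq_one_iff] at hr
  rcases hr with rfl | rfl
  · left; ext i j; simp [← h]
  · right; ext i j; fin_cases i <;> fin_cases j <;> simp [← h]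

theorem neg_one_mem_center {R : Type*} [CommRing R] : (-1 : SL(2, R)) ∈ Subgroup.center SL(2, R) := by
  rw [Subgroup.mem_center_iff]; intro g; simp

/-- A homomorphism from the free group that sends each `aᵢ ^ eᵢ` to the centre induces a projective
representation of the free product of cyclic groups. -/
def projRep {R : Type*} [CommRing R] {ι : Type} {e : ι → ℕ} (σ : FreeGroup ι →* SL(2, R))
    (hσ : ∀ i, σ (FreeGroup.of i) ^ e i ∈ Subgroup.center SL(2, R)) :
    CyclicFreeProduct e →* PSL(2, R) :=
  PresentedGroup.toGroup (f := fun i => (σ (FreeGroup.of i) : PSL(2, R))) (by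
    rintro _ ⟨i, rfl⟩
    simp only [map_pow, FreeGroup.lift_apply_of]
    rw [← QuotientGroup.mk_pow, QuotientGroup.eq_one_iff]
    exact hσ i)

theorem projRep_mk {R : Type*} [CommRing R] {ι : Type} {e : ι → ℕ} (σ : FreeGroup ι →* SL(2, R))
    (hσ : ∀ i, σ (FreeGroup.of i) ^ e i ∈ Subgroup.center SL(2, R)) (h : FreeGroup ι) :
    projRep σ hσ (PresentedGroup.mk _ h) = (σ h : PSL(2, R)) := by
  have hof (i : ι) : projRep σ hσ (PresentedGroup.of i) = (σ (FreeGroup.of i) : PSL(2, R)) := by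
    unfold projRep
    rw [PresentedGroup.toGroup.of]
  have : (projRep σ hσ).comp (PresentedGroup.mk _) = (QuotientGroup.mk' _).comp σ := by
    ext i
    exact hof i
  exact DFunLike.congr_fun this h

/-- `σ` need not descend to the free product, since `aᵢ ^ eᵢ` may go to `-1`; only its class in
`PSL` does. -/
theorem eq_or_eq_neg_of_mk_eq {R : Type*} [CommRing R] [IsDomain R] {ι : Type} {e : ι → ℕ}
    {σ : FreeGroup ι →* SL(2, R)}
    (hσ : ∀ i, σ (FreeGroup.of i) ^ e i ∈ Subgroup.center SL(2, R)) {g h : FreeGroup ι}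
    (hgh : (PresentedGroup.mk _ g : CyclicFreeProduct e) = PresentedGroup.mk _ h) :
    σ g = σ h ∨ σ g = -σ h := by
  have := congrArg (projRep σ hσ) hgh
  rw [projRep_mk, projRep_mk, QuotientGroup.eq] at this
  rcases eq_one_or_neg_one_of_mem_center this with h1 | h1
  · left; exact (inv_mul_eq_one.1 h1)
  · right; rw [inv_mul_eq_iff_eq_mul] at h1; simp [h1]

end ProjectiveRepresentations

/-! ### Reduced and cyclically reduced words. -/

section Words

variable {ι : Type}

/-- The word has nontrivial syllables, and consecutive syllables lie in different factors. -/
def IsReducedWord (e : ι → ℕ) (w : List (ι × ℤ)) : Prop :=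
  (∀ s ∈ w, ¬ (e s.1 : ℤ) ∣ s.2) ∧ w.IsChain (fun s t => s.1 ≠ t.1)

@[simp] theorem wordValue_nil : wordValue ([] : List (ι × ℤ)) = 1 := rfl

@[simp] theorem wordValue_cons (s : ι × ℤ) (w : List (ι × ℤ)) :
    wordValue (s :: w) = FreeGroup.of s.1 ^ s.2 * wordValue w := by
  simp [wordValue]

@[simp] theorem wordValue_append (v w : List (ι × ℤ)) :
    wordValue (v ++ w) = wordValue v * wordValue w := by
  simp [wordValue]

theorem exists_wordValue_eq (g : FreeGroup ι) : ∃ w, wordValue w = g := by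
  induction g using FreeGroup.induction_on with
  | C1 => exact ⟨[], rfl⟩
  | of i => exact ⟨[(i, 1)], by simp⟩
  | inv_of i _ => exact ⟨[(i, -1)], by simp⟩
  | mul x y hx hy =>
    obtain ⟨v, rfl⟩ := hx
    obtain ⟨w, rfl⟩ := hy
    exact ⟨v ++ w, by simp⟩

@[simp] theorem wordElt_nil (e : ι → ℕ) : wordElt e ([] : List (ι × ℤ)) = 1 := rfl

@[simp] theorem wordElt_append (e : ι → ℕ) (v w : List (ι × ℤ)) :
    wordElt e (v ++ w) = wordElt e v * wordElt e w := by
  simp [wordElt]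

theorem wordElt_cons (e : ι → ℕ) (s : ι × ℤ) (w : List (ι × ℤ)) :
    wordElt e (s :: w) = wordElt e [s] * wordElt e w := by
  simp [wordElt]

theorem wordElt_singleton (e : ι → ℕ) (i : ι) (k : ℤ) :
    wordElt e [(i, k)] = (PresentedGroup.of i : CyclicFreeProduct e) ^ k := by
  simp [wordElt, PresentedGroup.of]

theorem of_zpow_eq_one {e : ι → ℕ} {i : ι} {k : ℤ} (h : (e i : ℤ) ∣ k) :
    (PresentedGroup.of i : CyclicFreeProduct e) ^ k = 1 := by
  obtain ⟨m, rfl⟩ := h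
  have : (PresentedGroup.of i : CyclicFreeProduct e) ^ e i = 1 := by
    have := PresentedGroup.one_of_mem (rels := Set.range fun i : ι => FreeGroup.of i ^ e i)
      (x := FreeGroup.of i ^ e i) ⟨i, rfl⟩
    rwa [map_pow] at this
  rw [zpow_mul, zpow_natCast, this, one_zpow]

theorem exists_wordElt_eq {e : ι → ℕ} (g : CyclicFreeProduct e) : ∃ w, wordElt e w = g := by
  obtain ⟨h, rfl⟩ := PresentedGroup.mk_surjective _ g
  obtain ⟨w, rfl⟩ := exists_wordValue_eq h
  exact ⟨w, rfl⟩

/-- A word that is not reduced can be shortened. -/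
theorem exists_shorter_of_not_isReducedWord {e : ι → ℕ} {w : List (ι × ℤ)}
    (hw : ¬ IsReducedWord e w) : ∃ v, v.length < w.length ∧ wordElt e v = wordElt e w := by
  rw [IsReducedWord, not_and_or] at hw
  rcases hw with hw | hw
  · push Not at hw
    obtain ⟨⟨i, k⟩, hs, hk⟩ := hw
    obtain ⟨a, b, rfl⟩ := List.append_of_mem hs
    refine ⟨a ++ b, by simp, ?_⟩
    rw [wordElt_append, wordElt_append, wordElt_cons, wordElt_singleton, of_zpow_eq_one hk, one_mul]
  · rw [List.isChain_iff_forall_rel_of_append_cons_cons] at hw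
    push Not at hw
    obtain ⟨⟨i, k⟩, ⟨j, m⟩, a, b, rfl, h⟩ := hw
    obtain rfl : i = j := h
    refine ⟨a ++ (i, k + m) :: b, by simp, ?_⟩
    rw [wordElt_append, wordElt_append, wordElt_cons, wordElt_cons e (i, k), wordElt_cons e (i, m)]
    simp only [wordElt_singleton, zpow_add, mul_assoc]

theorem exists_isReducedWord {e : ι → ℕ} (g : CyclicFreeProduct e) :
    ∃ w, IsReducedWord e w ∧ wordElt e w = g := by
  classical
  obtain ⟨w, hw, hmin⟩ := exists_minimalFor_of_wellFoundedLT
    (fun w : List (ι × ℤ) => wordElt e w = g) List.length (exists_wordElt_eq g)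
  refine ⟨w, ?_, hw⟩
  by_contra h
  obtain ⟨v, hv, hvw⟩ := exists_shorter_of_not_isReducedWord h
  exact absurd (hmin (hvw.trans hw) hv.le) (by simpa using hv)

/-- Take a shortest word over the whole conjugacy class. -/
theorem exists_conj_isCyclicallyReducedWord {e : ι → ℕ} (g : CyclicFreeProduct e) :
    ∃ w, IsCyclicallyReducedWord e w ∧ IsConj (wordElt e w) g := by
  classical
  obtain ⟨w, hw, hmin⟩ := exists_minimalFor_of_wellFoundedLT
    (fun w : List (ι × ℤ) => IsConj (wordElt e w) g) List.length
    ((exists_wordElt_eq g).imp fun w hw => by rw [hw])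
  have hshort : ∀ v, IsConj (wordElt e v) (wordElt e w) → ¬ v.length < w.length := by
    intro v hv hlt
    exact absurd (hmin (hv.trans hw) hlt.le) (by simpa using hlt)
  have hred : IsReducedWord e w := by
    by_contra h
    obtain ⟨v, hv, hvw⟩ := exists_shorter_of_not_isReducedWord h
    exact hshort v (hvw ▸ IsConj.refl _) hv
  refine ⟨w, ⟨hred.1, hred.2, fun hlen heq => ?_⟩, hw⟩
  obtain ⟨⟨i, k⟩, t, rfl⟩ := List.exists_cons_of_ne_nil (l := w) (by rintro rfl; simp at hlen)
  have ht : t ≠ [] := by rintro rfl; simp at hlen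
  obtain ⟨u, ⟨j, m⟩, rfl⟩ : ∃ u s, t = u ++ [s] :=
    ⟨t.dropLast, t.getLast ht, (List.dropLast_append_getLast ht).symm⟩
  have hij : i = j := by
    rw [List.head?_cons, ← List.cons_append, List.getLast?_concat] at heq
    simpa using heq
  subst hij
  -- Conjugation carries the last syllable to the front, where it merges with the first.
  refine hshort ((i, m + k) :: u) (isConj_iff.2 ⟨(wordElt e [(i, m)])⁻¹, ?_⟩) (by simp)
  rw [wordElt_cons e (i, m + k), wordElt_cons e _ (u ++ _), wordElt_append]
  simp only [wordElt_singleton, zpow_add]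
  group

end Words

/-! ### Leading coefficients of polynomial matrices. -/

section LeadingCoefficients

/-- The entries of `M` have degree at most `d`, and `L` is the matrix of their `d`-th coefficients. -/
def HasLead (M : Matrix (Fin 2) (Fin 2) ℂ[X]) (d : ℕ) (L : Matrix (Fin 2) (Fin 2) ℂ) : Prop :=
  ∀ i j, (M i j).natDegree ≤ d ∧ (M i j).coeff d = L i j

theorem HasLead.mul {M M' : Matrix (Fin 2) (Fin 2) ℂ[X]} {d d' : ℕ}
    {L L' : Matrix (Fin 2) (Fin 2) ℂ} (h : HasLead M d L) (h' : HasLead M' d' L') :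
    HasLead (M * M') (d + d') (L * L') := by
  intro i j
  simp only [Matrix.mul_apply]
  constructor
  · exact natDegree_sum_le_of_forall_le _ _ fun k _ =>
      natDegree_mul_le_of_le (h i k).1 (h' k j).1
  · rw [finsetSum_coeff]
    refine Finset.sum_congr rfl fun k _ => ?_
    rw [coeff_mul_add_eq_of_natDegree_le (h i k).1 (h' k j).1, (h i k).2, (h' k j).2]

theorem HasLead.neg {M : Matrix (Fin 2) (Fin 2) ℂ[X]} {d : ℕ} {L : Matrix (Fin 2) (Fin 2) ℂ}
    (h : HasLead M d L) : HasLead (-M) d (-L) := by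
  intro i j
  simpa using h i j

theorem HasLead.unique {M : Matrix (Fin 2) (Fin 2) ℂ[X]} {d : ℕ} {L L' : Matrix (Fin 2) (Fin 2) ℂ}
    (h : HasLead M d L) (h' : HasLead M d L') : L = L' := by
  ext i j
  rw [← (h i j).2, (h' i j).2]

theorem HasLead.natDegree_trace {M : Matrix (Fin 2) (Fin 2) ℂ[X]} {d : ℕ}
    {L : Matrix (Fin 2) (Fin 2) ℂ} (h : HasLead M d L) (hL : L.trace ≠ 0) :
    M.trace.natDegree = d := by
  rw [Matrix.trace_fin_two] at *
  refine natDegree_eq_of_le_of_coeff_ne_zero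
    (natDegree_add_le_of_degree_le (h 0 0).1 (h 1 1).1) ?_
  rwa [coeff_add, (h 0 0).2, (h 1 1).2]

/-- The rank one matrix `(x, 1)ᵀ (1, -y)`. -/
def rankOne (x y : ℂ) : Matrix (Fin 2) (Fin 2) ℂ := !![x, -(x * y); 1, -y]

/-- The scalar `x' - y` is what distinct fixed points keep nonzero at each junction of a reduced
word. -/
theorem rankOne_mul (x y x' y' : ℂ) : rankOne x y * rankOne x' y' = (x' - y) • rankOne x y' := by
  ext i j
  fin_cases i <;> fin_cases j <;> simp [rankOne, Matrix.mul_apply, Fin.sum_univ_two] <;> ring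

theorem trace_rankOne (x y : ℂ) : (rankOne x y).trace = x - y := by
  simp [rankOne, Matrix.trace_fin_two, sub_eq_add_neg]

theorem eq_of_smul_rankOne_eq {a b x y x' y' : ℂ} (ha : a ≠ 0)
    (h : a • rankOne x y = b • rankOne x' y') : x = x' := by
  have h0 := congrFun (congrFun h 0) 0
  have h1 := congrFun (congrFun h 1) 0
  simp [rankOne] at h0 h1
  subst h1
  exact mul_left_cancel₀ ha h0

end LeadingCoefficients

/-! ### A representation over `ℂ[X]` with colliding fixed points. -/

section PolynomialRepresentation

/-- The combination `a + b N` where `N` is the involution with trace zero and fixed points `x` and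
`x + 2 / X`. -/
noncomputable def torusMatrix (x a b : ℂ) : Matrix (Fin 2) (Fin 2) ℂ[X] :=
  !![C (b * x) * X + C (a + b), C (-(b * (x * x))) * X + C (-(2 * b * x));
    C b * X + C 0, C (-(b * x)) * X + C (a - b)]

theorem det_torusMatrix (x a b : ℂ) : (torusMatrix x a b).det = C (a ^ 2 - b ^ 2) := by
  rw [torusMatrix, Matrix.det_fin_two_of]
  simp only [C_add, C_mul, C_neg, C_sub, C_pow, C_0, show (C 2 : ℂ[X]) = 2 from rfl]
  ring

/-- This is `(a + b N) (c + d N)` with `N ^ 2 = 1`. -/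
theorem torusMatrix_mul (x a b c d : ℂ) :
    torusMatrix x a b * torusMatrix x c d = torusMatrix x (a * c + b * d) (a * d + b * c) := by
  ext1 i j
  fin_cases i <;> fin_cases j <;>
    simp [torusMatrix, Matrix.mul_apply, Fin.sum_univ_two, show (C 2 : ℂ[X]) = 2 from rfl] <;> ring

/-- The torus of matrices in `SL(2, ℂ[X])` with fixed points `x` and `x + 2 / X`. -/
noncomputable def torusHom (x : ℂ) : ℂˣ →* SL(2, ℂ[X]) where
  -- The eigenvalues of `a + b N` are `a + b` and `a - b`; here they are `u` and `u⁻¹`.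
  toFun u := ⟨torusMatrix x (((u : ℂ) + (u⁻¹ : ℂˣ)) / 2) (((u : ℂ) - (u⁻¹ : ℂˣ)) / 2), by
    rw [det_torusMatrix, ← C_1]
    congr 1
    linear_combination u.mul_inv⟩
  map_one' := by
    ext i j
    fin_cases i <;> fin_cases j <;> simp [torusMatrix]
  map_mul' u v := by
    refine Subtype.ext (Eq.trans ?_ (torusMatrix_mul x _ _ _ _).symm)
    change torusMatrix x _ _ = _
    rw [mul_inv, Units.val_mul, Units.val_mul]
    congr 1 <;> ring

theorem torusHom_coe (x : ℂ) (u : ℂˣ) : (torusHom x u : Matrix (Fin 2) (Fin 2) ℂ[X]) =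
    torusMatrix x (((u : ℂ) + (u⁻¹ : ℂˣ)) / 2) (((u : ℂ) - (u⁻¹ : ℂˣ)) / 2) := rfl

theorem trace_torusHom (x : ℂ) (u : ℂˣ) :
    (torusHom x u : Matrix (Fin 2) (Fin 2) ℂ[X]).trace = C ((u : ℂ) + (u⁻¹ : ℂˣ)) := by
  have (a b : ℂ) : (torusMatrix x a b).trace = C (2 * a) := by
    rw [torusMatrix, Matrix.trace_fin_two_of]
    simp only [C_add, C_mul, C_neg, C_sub, show (C 2 : ℂ[X]) = 2 from rfl]
    ring
  rw [torusHom_coe, this]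
  congr 1
  ring

theorem torusHom_mem_center (x : ℂ) {u : ℂˣ} (hu : u ^ 2 = 1) :
    torusHom x u ∈ Subgroup.center SL(2, ℂ[X]) := by
  have hu' : (u : ℂ) ^ 2 = 1 := by rw [← Units.val_pow_eq_pow_val, hu, Units.val_one]
  rcases sq_eq_one_iff.1 hu' with h | h
  · rw [Units.val_eq_one] at h
    rw [h, map_one]
    exact one_mem _
  · have h : u = -1 := Units.ext h
    convert neg_one_mem_center (R := ℂ[X])
    ext i j
    fin_cases i <;> fin_cases j <;> simp [torusHom_coe, torusMatrix, h]

theorem hasLead_torusHom (x : ℂ) (u : ℂˣ) :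
    HasLead (torusHom x u) 1 ((((u : ℂ) - (u⁻¹ : ℂˣ)) / 2) • rankOne x x) := by
  intro i j
  rw [torusHom_coe, torusMatrix]
  fin_cases i <;> fin_cases j <;>
    exact ⟨natDegree_linear_le, by simp [rankOne]⟩

theorem sub_inv_div_two_ne_zero {u : ℂˣ} (hu : u ^ 2 ≠ 1) : ((u : ℂ) - (u⁻¹ : ℂˣ)) / 2 ≠ 0 := by
  intro h
  apply hu
  have : (u : ℂ) = (u⁻¹ : ℂˣ) := by linear_combination 2 * h
  rw [pow_two, ← eq_inv_iff_mul_eq_one]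
  exact Units.ext this

variable {ι : Type}

/-- The representation of the free group with `aᵢ ↦ torusHom (x i) (l i)`. -/
noncomputable def polyRep (x : ι → ℂ) (l : ι → ℂˣ) : FreeGroup ι →* SL(2, ℂ[X]) :=
  FreeGroup.lift fun i => torusHom (x i) (l i)

theorem polyRep_of_zpow (x : ι → ℂ) (l : ι → ℂˣ) (i : ι) (k : ℤ) :
    polyRep x l (FreeGroup.of i ^ k) = torusHom (x i) (l i ^ k) := by
  simp [polyRep]

theorem polyRep_of_pow_mem_center {e : ι → ℕ} (x : ι → ℂ) {l : ι → ℂˣ}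
    (hl : ∀ i, IsPrimitiveRoot (l i ^ 2) (e i)) (i : ι) :
    polyRep x l (FreeGroup.of i) ^ e i ∈ Subgroup.center SL(2, ℂ[X]) := by
  rw [← map_pow, ← zpow_natCast, polyRep_of_zpow]
  refine torusHom_mem_center _ ?_
  rw [zpow_natCast, pow_right_comm]
  exact (hl i).pow_eq_one

theorem zpow_sq_eq_one_iff {u : ℂˣ} {n : ℕ} (hu : IsPrimitiveRoot (u ^ 2) n) (k : ℤ) :
    (u ^ k) ^ 2 = 1 ↔ (n : ℤ) ∣ k := by
  rw [← hu.zpow_eq_one_iff_dvd]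
  constructor <;> intro h <;> rw [← h] <;> simp only [← zpow_natCast, ← zpow_mul, mul_comm]

theorem exists_isPrimitiveRoot_sq (e : ι → ℕ) : ∃ l : ι → ℂˣ, ∀ i, IsPrimitiveRoot (l i ^ 2) (e i) := by
  suffices h : ∀ n : ℕ, ∃ u : ℂˣ, IsPrimitiveRoot (u ^ 2) n by
    choose f hf using h
    exact ⟨fun i => f (e i), fun i => hf _⟩
  intro n
  rcases eq_or_ne n 0 with rfl | hn
  -- A primitive root of order `0` is an element of infinite order; `2 ^ 2` is one.
  · refine ⟨Units.mk0 2 two_ne_zero, by simp, fun m hm => ?_⟩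
    have h := congrArg (fun u : ℂˣ => ‖(u : ℂ)‖) hm
    simp only [Units.val_pow_eq_pow_val, Units.val_mk0, norm_pow, RCLike.norm_ofNat, Units.val_one,
      norm_one, ← pow_mul] at h
    rw [zero_dvd_iff]
    by_contra hm0
    rw [pow_eq_one_iff_of_nonneg (by norm_num) (by omega)] at h
    norm_num at h
  · obtain ⟨z, hz⟩ := IsAlgClosed.exists_pow_nat_eq (Complex.exp (2 * Real.pi * Complex.I / n))
      (n := 2) two_pos
    have hz0 : z ≠ 0 := by
      rintro rfl
      exact Complex.exp_ne_zero _ (by rw [← hz]; simp)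
    refine ⟨Units.mk0 z hz0, ?_⟩
    rw [← IsPrimitiveRoot.coe_units_iff]
    simpa [hz] using Complex.isPrimitiveRoot_exp n hn

/-- The leading coefficient of the image of a reduced word. -/
theorem exists_hasLead_polyRep {e : ι → ℕ} {x : ι → ℂ} (hx : Function.Injective x) {l : ι → ℂˣ}
    (hl : ∀ i, IsPrimitiveRoot (l i ^ 2) (e i)) {w : List (ι × ℤ)} (hw : IsReducedWord e w)
    {s t : ι × ℤ} (hs : s ∈ w.head?) (ht : t ∈ w.getLast?) :
    ∃ c : ℂ, c ≠ 0 ∧ HasLead (polyRep x l (wordValue w)) w.length (c • rankOne (x s.1) (x t.1)) := by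
  induction w generalizing s with
  | nil => simp at hs
  | cons a w ih =>
    obtain rfl : a = s := by simpa using hs
    have ha : ((l a.1 ^ a.2 : ℂˣ) - ((l a.1 ^ a.2)⁻¹ : ℂˣ) : ℂ) / 2 ≠ 0 :=
      sub_inv_div_two_ne_zero fun h => hw.1 a (by simp) ((zpow_sq_eq_one_iff (hl _) _).1 h)
    have hlead := hasLead_torusHom (x a.1) (l a.1 ^ a.2)
    rw [← polyRep_of_zpow] at hlead
    rcases w with _ | ⟨b, w⟩
    · obtain rfl : a = t := by simpa using ht
      exact ⟨_, ha, by simpa using hlead⟩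
    · obtain ⟨c, hc, hL⟩ := ih ⟨fun s hs => hw.1 s (List.mem_cons_of_mem _ hs), hw.2.tail⟩
        (s := b) (by simp) (by simpa using ht)
      have hab : a.1 ≠ b.1 := (List.isChain_cons_cons.1 hw.2).1
      refine ⟨_, mul_ne_zero (mul_ne_zero ha hc) (sub_ne_zero.2 (hx.ne hab.symm)), ?_⟩
      rw [wordValue_cons, map_mul, Matrix.SpecialLinearGroup.coe_mul, List.length_cons, add_comm]
      have := hlead.mul hL
      rwa [smul_mul_smul_comm, rankOne_mul, smul_smul] at this

end PolynomialRepresentation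

/-! ### Generic specializations with prescribed trace. -/

section GenericRepresentations

variable {ι : Type}

/-- The quotient map from the free group to the free product of cyclic groups. -/
abbrev cyclicMk (e : ι → ℕ) : FreeGroup ι →* CyclicFreeProduct e := PresentedGroup.mk _

theorem cyclicMk_surjective (e : ι → ℕ) : Function.Surjective (cyclicMk e) :=
  PresentedGroup.mk_surjective _

theorem trace_sq_eq_of_isConj {R : Type*} [CommRing R] [IsDomain R] {e : ι → ℕ}
    {σ : FreeGroup ι →* SL(2, R)}
    (hσ : ∀ i, σ (FreeGroup.of i) ^ e i ∈ Subgroup.center SL(2, R)) {g h : FreeGroup ι}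
    (hgh : IsConj (cyclicMk e g) (cyclicMk e h)) :
    (σ g : Matrix (Fin 2) (Fin 2) R).trace ^ 2 = (σ h : Matrix (Fin 2) (Fin 2) R).trace ^ 2 := by
  obtain ⟨c, hc⟩ := isConj_iff.1 hgh
  obtain ⟨c, rfl⟩ := cyclicMk_surjective e c
  rw [← map_inv, ← map_mul, ← map_mul] at hc
  have htr : (σ (c * g * c⁻¹) : Matrix (Fin 2) (Fin 2) R).trace =
      (σ g : Matrix (Fin 2) (Fin 2) R).trace := by
    rw [map_mul, map_mul, Matrix.SpecialLinearGroup.coe_mul, Matrix.trace_mul_comm,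
      ← Matrix.SpecialLinearGroup.coe_mul, map_inv, inv_mul_cancel_left]
  rcases eq_or_eq_neg_of_mk_eq hσ hc with h | h
  · rw [← htr, h]
  · rw [← htr, h]; simp

/-- The leading matrix has trace a nonzero multiple of `x` at the first letter minus `x` at the
last, and cyclic reduction makes these letters differ. -/
theorem natDegree_trace_polyRep {e : ι → ℕ} {x : ι → ℂ} (hx : Function.Injective x) {l : ι → ℂˣ}
    (hl : ∀ i, IsPrimitiveRoot (l i ^ 2) (e i)) {w : List (ι × ℤ)}
    (hw : IsCyclicallyReducedWord e w) (hlen : 2 ≤ w.length) :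
    (polyRep x l (wordValue w) : Matrix (Fin 2) (Fin 2) ℂ[X]).trace.natDegree = w.length := by
  have hne : w ≠ [] := by rintro rfl; simp at hlen
  obtain ⟨c, hc, h⟩ := exists_hasLead_polyRep hx hl (w := w) ⟨hw.1, hw.2.1⟩
    (List.head?_eq_some_head hne) (List.getLast?_eq_some_getLast hne)
  refine h.natDegree_trace ?_
  rw [Matrix.trace_smul, trace_rankOne]
  refine smul_ne_zero hc (sub_ne_zero.2 (hx.ne fun h' => hw.2.2 hlen ?_))
  rw [List.head?_eq_some_head hne, List.getLast?_eq_some_getLast hne, Option.map_some,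
    Option.map_some, h']

/-- A nontrivial element with bounded trace is conjugate into a factor. -/
theorem natDegree_trace_pos_or_isConj {e : ι → ℕ} {x : ι → ℂ} (hx : Function.Injective x)
    {l : ι → ℂˣ} (hl : ∀ i, IsPrimitiveRoot (l i ^ 2) (e i)) {g : FreeGroup ι}
    (hg : cyclicMk e g ≠ 1) :
    0 < (polyRep x l g : Matrix (Fin 2) (Fin 2) ℂ[X]).trace.natDegree ∨
      ∃ i, ∃ k : ℤ, ¬ (e i : ℤ) ∣ k ∧ IsConj (cyclicMk e (FreeGroup.of i ^ k)) (cyclicMk e g) := by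
  obtain ⟨w, hw, hwg⟩ := exists_conj_isCyclicallyReducedWord (cyclicMk e g)
  match w, hw, hwg with
  | [], hw, hwg =>
    rw [wordElt_nil, isConj_one_right] at hwg
    exact absurd hwg hg
  | [(i, k)], hw, hwg =>
    refine Or.inr ⟨i, k, hw.1 (i, k) (by simp), ?_⟩
    simpa [wordElt] using hwg
  | a :: b :: t, hw, hwg =>
    left
    have h1 := natDegree_trace_polyRep hx hl hw (by simp)
    have h2 := congrArg natDegree
      (trace_sq_eq_of_isConj (polyRep_of_pow_mem_center x hl) (g := wordValue (a :: b :: t)) hwg)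
    rw [natDegree_pow, natDegree_pow, h1, List.length_cons] at h2
    omega

/-- The specialization of `polyRep` at `y`. -/
noncomputable def evalRep (x : ι → ℂ) (l : ι → ℂˣ) (y : ℂ) : FreeGroup ι →* SL(2, ℂ) :=
  (Matrix.SpecialLinearGroup.map (evalRingHom y)).comp (polyRep x l)

theorem trace_evalRep (x : ι → ℂ) (l : ι → ℂˣ) (y : ℂ) (g : FreeGroup ι) :
    (evalRep x l y g : Matrix (Fin 2) (Fin 2) ℂ).trace =
      (polyRep x l g : Matrix (Fin 2) (Fin 2) ℂ[X]).trace.eval y := by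
  simp [evalRep, Matrix.trace_fin_two]

theorem map_mem_center {R S : Type*} [CommRing R] [IsDomain R] [CommRing S] (f : R →+* S)
    {M : SL(2, R)} (hM : M ∈ Subgroup.center SL(2, R)) :
    Matrix.SpecialLinearGroup.map f M ∈ Subgroup.center SL(2, S) := by
  rcases eq_one_or_neg_one_of_mem_center hM with rfl | rfl
  · simp
  · convert neg_one_mem_center (R := S)
    ext i j
    fin_cases i <;> fin_cases j <;> simp

/-- A representation of the free group in `SL(2, ℂ)` that induces a projective representation of the
free product of cyclic groups in which no nontrivial element is parabolic or trivial. -/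
structure IsGenericRep (e : ι → ℕ) (σ : FreeGroup ι →* SL(2, ℂ)) : Prop where
  pow_mem_center : ∀ i, σ (FreeGroup.of i) ^ e i ∈ Subgroup.center SL(2, ℂ)
  trace_sq_ne : ∀ g, cyclicMk e g ≠ 1 → (σ g : Matrix (Fin 2) (Fin 2) ℂ).trace ^ 2 ≠ 4

/-- There are countably many `g`, and each excludes finitely many `y`: a nonconstant trace
polynomial is `±2` finitely often, while an element conjugate into a factor has, up to sign,
constant trace `u + u⁻¹` with `u ^ 2 ≠ 1`, which is never `±2`. -/
theorem countable_not_isGenericRep [Countable ι] {e : ι → ℕ} {x : ι → ℂ}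
    (hx : Function.Injective x) {l : ι → ℂˣ} (hl : ∀ i, IsPrimitiveRoot (l i ^ 2) (e i)) :
    {y | ¬ IsGenericRep e (evalRep x l y)}.Countable := by
  have hcenter (y : ℂ) (i : ι) :
      evalRep x l y (FreeGroup.of i) ^ e i ∈ Subgroup.center SL(2, ℂ) := by
    have := map_mem_center (evalRingHom y) (polyRep_of_pow_mem_center x hl i)
    rwa [map_pow] at this
  have hfin (g : FreeGroup ι) (hg : cyclicMk e g ≠ 1) :
      {y | (evalRep x l y g : Matrix (Fin 2) (Fin 2) ℂ).trace ^ 2 = 4}.Finite := by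
    rcases natDegree_trace_pos_or_isConj hx hl hg with h | ⟨i, k, hk, hconj⟩
    · set P := (polyRep x l g : Matrix (Fin 2) (Fin 2) ℂ[X]).trace
      have hP : P ^ 2 - C 4 ≠ 0 := by
        intro h0
        have := congrArg natDegree (sub_eq_zero.1 h0)
        rw [natDegree_pow, natDegree_C] at this
        omega
      refine (P ^ 2 - C 4).roots.toFinset.finite_toSet.subset fun y hy => ?_
      rw [Set.mem_ofPred_eq, trace_evalRep] at hy
      simp [hP, IsRoot, P, hy]
    · convert Set.finite_empty
      rw [Set.eq_empty_iff_forall_notMem]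
      intro y hy
      rw [Set.mem_ofPred_eq, ← trace_sq_eq_of_isConj (hcenter y) hconj, trace_evalRep,
        polyRep_of_zpow, trace_torusHom, eval_C] at hy
      refine sub_inv_div_two_ne_zero
        (fun h => hk ((zpow_sq_eq_one_iff (hl _) _).1 h)) (u := l i ^ k) ?_
      have h1 := (l i ^ k).mul_inv
      rw [← sq_eq_zero_iff]
      linear_combination hy / 4 - h1
  refine (Set.countable_iUnion fun g : FreeGroup ι =>
    Set.countable_iUnion fun hg : cyclicMk e g ≠ 1 => (hfin g hg).countable).mono ?_
  intro y hy
  by_contra h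
  simp only [Set.mem_iUnion, not_exists] at h
  exact hy ⟨hcenter y, fun g hg => h g hg⟩

/-- The trace polynomial `P` is nonconstant, hence surjective on `ℂ`; the exceptional values are the
`P`-images of the nongeneric parameters. -/
theorem exists_isGenericRep_of_two_le_length [Countable ι] {e : ι → ℕ} {w : List (ι × ℤ)}
    (hw : IsCyclicallyReducedWord e w) (hlen : 2 ≤ w.length) :
    ∃ B : Set ℂ, B.Countable ∧ ∀ τ ∉ B, ∃ σ, IsGenericRep e σ ∧
      (σ (wordValue w) : Matrix (Fin 2) (Fin 2) ℂ).trace = τ := by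
  obtain ⟨f, hf⟩ := exists_injective_nat ι
  obtain ⟨l, hl⟩ := exists_isPrimitiveRoot_sq e
  set x : ι → ℂ := fun i => f i with hx
  have hxi : Function.Injective x := Nat.cast_injective.comp hf
  set P := (polyRep x l (wordValue w) : Matrix (Fin 2) (Fin 2) ℂ[X]).trace with hP
  have hdeg : P.natDegree = w.length := natDegree_trace_polyRep hxi hl hw hlen
  refine ⟨_, (countable_not_isGenericRep hxi hl).image (fun y => P.eval y), fun τ hτ => ?_⟩
  obtain ⟨y, hy⟩ := IsAlgClosed.exists_root (P - C τ) (by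
    refine (natDegree_pos_iff_degree_pos.1 ?_).ne'
    rw [natDegree_sub_C]
    omega)
  have hy : P.eval y = τ := by simpa [sub_eq_zero] using hy
  refine ⟨evalRep x l y, ?_, by rw [trace_evalRep]; exact hy⟩
  by_contra h
  exact hτ ⟨y, h, hy⟩

theorem exists_notMem_of_countable {s : Set ℂ} (hs : s.Countable) : ∃ z, z ∉ s :=
  (hs.dense_compl ℝ).nonempty

/-- Solve `z + z⁻¹ = τ` and take a `|m|`-th root; the symmetry in `z` and `z⁻¹` absorbs the sign of
`m`. -/
theorem exists_zpow_add_zpow_inv_eq {m : ℤ} (hm : m ≠ 0) (τ : ℂ) :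
    ∃ u : ℂˣ, ((u ^ m : ℂˣ) + ((u ^ m)⁻¹ : ℂˣ) : ℂ) = τ := by
  obtain ⟨z, hz⟩ := IsAlgClosed.exists_root (X ^ 2 - C τ * X + 1 : ℂ[X]) (by
    rw [show (X ^ 2 - C τ * X + 1 : ℂ[X]) = C 1 * X ^ 2 + C (-τ) * X + C 1 by simp; ring,
      degree_quadratic one_ne_zero]
    decide)
  have hz : z ^ 2 - τ * z + 1 = 0 := by simpa using hz
  have hz0 : z ≠ 0 := by rintro rfl; simp at hz
  obtain ⟨r, hr⟩ := IsAlgClosed.exists_pow_nat_eq z (Int.natAbs_pos.2 hm)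
  have hr0 : r ≠ 0 := by
    rintro rfl
    rw [zero_pow (Int.natAbs_ne_zero.2 hm)] at hr
    exact hz0 hr.symm
  have hu : Units.mk0 r hr0 ^ m.natAbs = Units.mk0 z hz0 := Units.ext (by simpa using hr)
  have hsum : z + z⁻¹ = τ := by field_simp; linear_combination hz
  refine ⟨Units.mk0 r hr0, ?_⟩
  rcases Int.natAbs_eq m with h | h <;> rw [h]
  · rw [zpow_natCast, hu]; simpa using hsum
  · rw [zpow_neg, zpow_natCast, hu, inv_inv]; simpa [add_comm] using hsum

/-- The trace of a power of one generator does not depend on `X`, so the eigenvalue of that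
generator is varied instead. Since `e i = 0`, any unit of infinite order is allowed. -/
theorem exists_isGenericRep_of_singleton [Countable ι] {e : ι → ℕ} {i : ι} (hi : e i = 0) {m : ℤ}
    (hm : m ≠ 0) :
    ∃ B : Set ℂ, B.Countable ∧ ∀ τ ∉ B, ∃ σ, IsGenericRep e σ ∧
      (σ (FreeGroup.of i ^ m) : Matrix (Fin 2) (Fin 2) ℂ).trace = τ := by
  classical
  obtain ⟨f, hf⟩ := exists_injective_nat ι
  obtain ⟨l, hl⟩ := exists_isPrimitiveRoot_sq e
  set x : ι → ℂ := fun i => f i with hx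
  have hxi : Function.Injective x := Nat.cast_injective.comp hf
  have hcount : {u : ℂˣ | IsOfFinOrder u}.Countable := by
    refine (Set.countable_iUnion fun n : ℕ => Set.countable_iUnion fun hn : 0 < n =>
      (Set.Finite.countable (s := {u : ℂˣ | u ^ n = 1}) ?_)).mono (s₁ := {u : ℂˣ | IsOfFinOrder u}) ?_
    · refine Set.Finite.of_finite_image (f := Units.val) ?_ Units.val_injective.injOn
      refine (nthRoots n (1 : ℂ)).toFinset.finite_toSet.subset ?_
      rintro _ ⟨u, hu, rfl⟩
      have hu : u ^ n = 1 := hu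
      simp [mem_nthRoots hn, ← Units.val_pow_eq_pow_val, hu]
    · intro u hu
      obtain ⟨n, hn, h⟩ := isOfFinOrder_iff_pow_eq_one.1 hu
      simp only [Set.mem_iUnion]
      exact ⟨n, hn, h⟩
  refine ⟨_, hcount.image fun u => ((u ^ m : ℂˣ) + ((u ^ m)⁻¹ : ℂˣ) : ℂ), fun τ hτ => ?_⟩
  obtain ⟨u, hu⟩ := exists_zpow_add_zpow_inv_eq hm τ
  have hu1 : ¬ IsOfFinOrder u := fun h => hτ ⟨u, h, hu⟩
  have hl' : ∀ j, IsPrimitiveRoot (Function.update l i u j ^ 2) (e j) := by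
    intro j
    rcases eq_or_ne j i with rfl | hj
    · rw [Function.update_self, hi]
      refine ⟨pow_zero _, fun n hn => ?_⟩
      by_contra h0
      rw [zero_dvd_iff] at h0
      exact hu1 (isOfFinOrder_iff_pow_eq_one.2 ⟨2 * n, by omega, by rw [pow_mul, hn]⟩)
    · rw [Function.update_of_ne hj]; exact hl j
  obtain ⟨y, hy⟩ := exists_notMem_of_countable (countable_not_isGenericRep hxi hl')
  refine ⟨evalRep x (Function.update l i u) y, not_not.1 hy, ?_⟩
  rw [trace_evalRep, polyRep_of_zpow, trace_torusHom, eval_C, Function.update_self, hu]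

theorem exists_isGenericRep [Countable ι] {e : ι → ℕ} {w : List (ι × ℤ)}
    (hw : IsCyclicallyReducedWord e w) (hinf : ¬ IsOfFinOrder (wordElt e w)) :
    ∃ B : Set ℂ, B.Countable ∧ ∀ τ ∉ B, ∃ σ, IsGenericRep e σ ∧
      (σ (wordValue w) : Matrix (Fin 2) (Fin 2) ℂ).trace = τ := by
  match w, hw, hinf with
  | [], hw, hinf => exact absurd IsOfFinOrder.one hinf
  | [(i, m)], hw, hinf =>
    have hm : m ≠ 0 := by
      rintro rfl
      exact hw.1 (i, 0) (by simp) (dvd_zero _)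
    have hi : e i = 0 := by
      by_contra hi
      rw [wordElt_singleton] at hinf
      refine hinf (IsOfFinOrder.zpow (isOfFinOrder_iff_pow_eq_one.2 ⟨e i, pos_iff_ne_zero.2 hi, ?_⟩))
      rw [← zpow_natCast]
      exact of_zpow_eq_one dvd_rfl
    simpa using exists_isGenericRep_of_singleton hi hm
  | a :: b :: t, hw, hinf => exact exists_isGenericRep_of_two_le_length hw (by simp)

end GenericRepresentations

/-! ### Trace identities and commuting matrices in `SL(2)`. -/

section Traces

variable {R : Type*} [CommRing R]

/-- Cayley–Hamilton: `B + B⁻¹` is the scalar `tr B`. -/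
theorem trace_mul_add_trace_mul_inv (A B : SL(2, R)) :
    (A * B : SL(2, R)).val.trace + (A * B⁻¹ : SL(2, R)).val.trace = A.val.trace * B.val.trace := by
  simp only [Matrix.SpecialLinearGroup.coe_mul, Matrix.SpecialLinearGroup.coe_inv,
    Matrix.adjugate_fin_two, Matrix.trace_fin_two, Matrix.mul_apply, Fin.sum_univ_two]
  simp
  ring

theorem trace_sq (A : SL(2, R)) : (A * A : SL(2, R)).val.trace = A.val.trace ^ 2 - 2 := by
  have := trace_mul_add_trace_mul_inv A A
  rw [mul_inv_cancel, Matrix.SpecialLinearGroup.coe_one, Matrix.trace_one] at this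
  simp at this
  linear_combination this

theorem trace_mul_mul_trace_mul_inv {A B : SL(2, R)} (h : Commute A B) :
    (A * B : SL(2, R)).val.trace * (A * B⁻¹ : SL(2, R)).val.trace =
      A.val.trace ^ 2 + B.val.trace ^ 2 - 4 := by
  rw [← trace_mul_add_trace_mul_inv, show A * B * (A * B⁻¹) = A * A by
      rw [h.eq, mul_assoc, ← mul_assoc A A, (h.mul_left h).inv_right.eq, mul_inv_cancel_left],
    show A * B * (A * B⁻¹)⁻¹ = B * B by
      rw [mul_inv_rev, inv_inv, mul_assoc, ← mul_assoc B B, ← mul_assoc,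
        (h.mul_right h).eq, mul_inv_cancel_right], trace_sq, trace_sq]
  ring

theorem commute_of_commute [IsDomain R] {A B T : SL(2, R)} (hT : T.val.trace ^ 2 ≠ 4)
    (hA : Commute A T) (hB : Commute B T) : Commute A B := by
  have key : T.val 0 1 ≠ 0 ∨ T.val 1 0 ≠ 0 ∨ T.val 0 0 ≠ T.val 1 1 := by
    by_contra! h
    obtain ⟨h1, h2, h3⟩ := h
    have hd := T.det_coe
    rw [Matrix.det_fin_two, h1, h3] at hd
    rw [Matrix.trace_fin_two, h3] at hT
    apply hT
    linear_combination 4 * hd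
  -- Matrices commute exactly when the vectors (upper right, lower left, diagonal difference) are
  -- parallel. By `key` the vector of `T` is nonzero, so being parallel to it is transitive.
  have eqs : ∀ {M N : SL(2, R)}, Commute M N ↔
      (M.val 0 1 * N.val 1 0 = N.val 0 1 * M.val 1 0 ∧
      M.val 0 1 * (N.val 0 0 - N.val 1 1) = N.val 0 1 * (M.val 0 0 - M.val 1 1) ∧
      M.val 1 0 * (N.val 0 0 - N.val 1 1) = N.val 1 0 * (M.val 0 0 - M.val 1 1)) := by
    intro M N
    rw [commute_iff_eq, Matrix.SpecialLinearGroup.ext_iff]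
    simp only [Fin.forall_fin_two, Matrix.SpecialLinearGroup.coe_mul, Matrix.mul_apply,
      Fin.sum_univ_two]
    constructor
    · rintro ⟨⟨h1, h2⟩, h3, h4⟩
      refine ⟨?_, ?_, ?_⟩
      · linear_combination h1
      · linear_combination -h2
      · linear_combination h3
    · rintro ⟨h1, h2, h3⟩
      refine ⟨⟨?_, ?_⟩, ?_, ?_⟩
      · linear_combination h1
      · linear_combination -h2
      · linear_combination h3
      · linear_combination -h1
  rw [eqs] at hA hB ⊢
  obtain ⟨a1, a2, a3⟩ := hA
  obtain ⟨b1, b2, b3⟩ := hB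
  rw [← sub_ne_zero (a := T.val 0 0)] at key
  generalize T.val 0 0 - T.val 1 1 = t₃ at *
  generalize A.val 0 0 - A.val 1 1 = a₃ at *
  generalize B.val 0 0 - B.val 1 1 = b₃ at *
  rcases key with h | h | h <;> refine ⟨?_, ?_, ?_⟩ <;> apply mul_left_cancel₀ h <;> grind

end Traces

/-! ### Centralizers in free products of cyclic groups. -/

section Centralizers

variable {ι : Type}

/-- The traces of `A B` and `A B⁻¹` have product of degree at most `2 deg tr A`. If neither degree
were below `deg tr A`, both would equal it, yet their sum `tr A * tr B` has larger degree. -/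
theorem natDegree_trace_le_or_le {A B : SL(2, ℂ[X])} (h : Commute A B)
    (hB : 0 < B.val.trace.natDegree) (hBA : B.val.trace.natDegree ≤ A.val.trace.natDegree) :
    (A * B : SL(2, ℂ[X])).val.trace.natDegree < A.val.trace.natDegree ∨
      (A * B⁻¹ : SL(2, ℂ[X])).val.trace.natDegree < A.val.trace.natDegree := by
  have hadd := congrArg natDegree (trace_mul_add_trace_mul_inv A B)
  have hmul := congrArg natDegree (trace_mul_mul_trace_mul_inv h)
  set p := (A * B : SL(2, ℂ[X])).val.trace
  set q := (A * B⁻¹ : SL(2, ℂ[X])).val.trace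
  set a := A.val.trace
  set b := B.val.trace
  have ha0 : a ≠ 0 := by rintro h; rw [h] at hBA; simp at hBA; omega
  have hb0 : b ≠ 0 := by rintro h; rw [h] at hB; simp at hB
  by_cases hp : p = 0
  · left; rw [hp, natDegree_zero]; omega
  by_cases hq : q = 0
  · right; rw [hq, natDegree_zero]; omega
  rw [natDegree_mul ha0 hb0] at hadd
  rw [natDegree_mul hp hq] at hmul
  have h1 := natDegree_add_le p q
  have h2 : (a ^ 2 + b ^ 2 - 4).natDegree ≤ 2 * a.natDegree := by
    rw [show (4 : ℂ[X]) = C 4 from rfl, natDegree_sub_C]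
    refine natDegree_add_le_of_degree_le ?_ ?_ <;> rw [natDegree_pow]
    omega
  omega

/-- The centralizer of a nontrivial element of a factor lies in that factor. -/
theorem mem_zpowers_of_commute_of_zpow [Countable ι] {e : ι → ℕ} {i : ι} {k : ℤ}
    (hk : ¬ (e i : ℤ) ∣ k) {g : CyclicFreeProduct e}
    (h : Commute g (PresentedGroup.of i ^ k)) :
    g ∈ Subgroup.zpowers (PresentedGroup.of i : CyclicFreeProduct e) := by
  obtain ⟨f, hf⟩ := exists_injective_nat ι
  obtain ⟨l, hl⟩ := exists_isPrimitiveRoot_sq e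
  set x : ι → ℂ := fun i => f i with hx
  have hxi : Function.Injective x := Nat.cast_injective.comp hf
  -- Multiplying by `a_i ^ k` on the left puts `x i` in the leading column, on the right `x s.1`.
  -- Only the left product needs a nonzero leading matrix; the right one may cancel.
  have key : ∀ (s : ι × ℤ) (t : List (ι × ℤ)), IsReducedWord e (s :: t) → s.1 ≠ i →
      ¬ Commute (wordElt e (s :: t)) (PresentedGroup.of i ^ k) := by
    intro s t hw hs hcomm
    obtain ⟨c, hc, hlead⟩ := exists_hasLead_polyRep hxi hl hw (s := s) (by simp)
      (List.getLast?_eq_some_getLast (List.cons_ne_nil s t))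
    have ha : ((l i ^ k : ℂˣ) - ((l i ^ k)⁻¹ : ℂˣ) : ℂ) / 2 ≠ 0 :=
      sub_inv_div_two_ne_zero fun h => hk ((zpow_sq_eq_one_iff (hl _) _).1 h)
    have hlead' := hasLead_torusHom (x i) (l i ^ k)
    rw [← polyRep_of_zpow] at hlead'
    have hc' : cyclicMk e (FreeGroup.of i ^ k * wordValue (s :: t)) =
        cyclicMk e (wordValue (s :: t) * FreeGroup.of i ^ k) := by
      simpa [wordElt, PresentedGroup.of] using hcomm.eq.symm
    have h1 := hlead'.mul hlead
    have h2 := hlead.mul hlead'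
    rw [← Matrix.SpecialLinearGroup.coe_mul, ← map_mul, smul_mul_smul_comm, rankOne_mul,
      smul_smul] at h1 h2
    rw [add_comm] at h2
    have hne : x s.1 - x i ≠ 0 := sub_ne_zero.2 (hxi.ne hs)
    rcases eq_or_eq_neg_of_mk_eq (polyRep_of_pow_mem_center x hl) hc' with h3 | h3
    · rw [h3] at h1
      exact hs (hxi (eq_of_smul_rankOne_eq (mul_ne_zero (mul_ne_zero ha hc) hne)
        (h1.unique h2)).symm)
    · rw [h3, Matrix.SpecialLinearGroup.coe_neg] at h1
      have h4 := h1.unique h2.neg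
      rw [← neg_smul] at h4
      exact hs (hxi (eq_of_smul_rankOne_eq (mul_ne_zero (mul_ne_zero ha hc) hne) h4).symm)
  obtain ⟨w, hw, rfl⟩ := exists_isReducedWord g
  match w, hw, h with
  | [], hw, h => exact one_mem _
  | [(j, m)], hw, h =>
    by_cases hj : j = i
    · subst hj; exact ⟨m, (wordElt_singleton _ _ _).symm⟩
    · exact absurd h (key _ _ hw hj)
  | (j, m) :: b :: t, hw, h =>
    by_cases hj : j = i
    · subst hj
      -- The first syllable commutes with `a_j ^ k`, so it can be stripped off.
      refine absurd ?_ (key b t ⟨fun s hs => hw.1 s (List.mem_cons_of_mem _ hs), hw.2.tail⟩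
        (List.isChain_cons_cons.1 hw.2).1.symm)
      rw [wordElt_cons, wordElt_singleton] at h
      have := ((Commute.refl (PresentedGroup.of j : CyclicFreeProduct e)).zpow_zpow m k).inv_left.mul_left h
      rwa [inv_mul_cancel_left] at this
    · exact absurd h (key _ _ hw hj)

/-- Commuting up to the sign `-1` would make the image of `u` conjugate to its negative, forcing
trace zero. -/
theorem commute_polyRep {e : ι → ℕ} {x : ι → ℂ} {l : ι → ℂˣ}
    (hl : ∀ i, IsPrimitiveRoot (l i ^ 2) (e i)) {g u : FreeGroup ι}
    (hu : 0 < (polyRep x l u).val.trace.natDegree) (h : Commute (cyclicMk e g) (cyclicMk e u)) :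
    Commute (polyRep x l g) (polyRep x l u) := by
  have h' : cyclicMk e (g * u) = cyclicMk e (u * g) := by simpa using h.eq
  rcases eq_or_eq_neg_of_mk_eq (polyRep_of_pow_mem_center x hl) h' with h1 | h1
  · rw [map_mul, map_mul] at h1
    exact h1
  · exfalso
    rw [map_mul, map_mul] at h1
    have h2 : polyRep x l g * polyRep x l u * (polyRep x l g)⁻¹ = - polyRep x l u := by
      rw [h1]; simp
    have h3 := congrArg (fun M => M.val.trace) h2
    rw [Matrix.SpecialLinearGroup.coe_mul, Matrix.trace_mul_comm,
      ← Matrix.SpecialLinearGroup.coe_mul, inv_mul_cancel_left, Matrix.SpecialLinearGroup.coe_neg,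
      Matrix.trace_neg, self_eq_neg] at h3
    rw [h3] at hu
    simp at hu

/-- Centralizers of nontrivial elements of a free product of cyclic groups are cyclic. -/
theorem exists_forall_commute_mem_zpowers [Countable ι] {e : ι → ℕ} {u : CyclicFreeProduct e}
    (hu : u ≠ 1) : ∃ z : CyclicFreeProduct e, ∀ g, Commute g u → g ∈ Subgroup.zpowers z := by
  obtain ⟨f, hf⟩ := exists_injective_nat ι
  obtain ⟨l, hl⟩ := exists_isPrimitiveRoot_sq e
  set x : ι → ℂ := fun i => f i with hx
  have hxi : Function.Injective x := Nat.cast_injective.comp hf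
  -- If `u` commutes with a nontrivial element conjugate into a factor, it lies in that conjugate of
  -- the factor, and so does its centralizer.
  by_cases hA : ∃ (c : CyclicFreeProduct e) (i : ι) (k : ℤ), ¬ (e i : ℤ) ∣ k ∧
      Commute u (c * PresentedGroup.of i ^ k * c⁻¹)
  · obtain ⟨c, i, k, hk, hc⟩ := hA
    have hconj : ∀ {g v : CyclicFreeProduct e}, Commute g (c * v * c⁻¹) → Commute (c⁻¹ * g * c) v := by
      intro g v h
      have := h.map (MulAut.conj c⁻¹)
      simpa [mul_assoc] using this
    obtain ⟨m, hm⟩ := mem_zpowers_of_commute_of_zpow hk (hconj hc)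
    have hu' : u = c * PresentedGroup.of i ^ m * c⁻¹ := by
      simp only at hm
      rw [hm]; group
    have hm' : ¬ (e i : ℤ) ∣ m := by
      intro h
      rw [of_zpow_eq_one h] at hu'
      exact hu (by simpa using hu')
    refine ⟨c * PresentedGroup.of i * c⁻¹, fun g hg => ?_⟩
    rw [hu'] at hg
    obtain ⟨n, hn⟩ := mem_zpowers_of_commute_of_zpow hm' (hconj hg)
    refine ⟨n, ?_⟩
    simp only at hn ⊢
    rw [conj_zpow, hn]
    group
  · have hpos : ∀ g, Commute (cyclicMk e g) u → cyclicMk e g ≠ 1 →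
        0 < (polyRep x l g).val.trace.natDegree := by
      intro g hg hg1
      refine (natDegree_trace_pos_or_isConj hxi hl hg1).resolve_right ?_
      rintro ⟨i, k, hk, hconj⟩
      obtain ⟨c, hc⟩ := isConj_iff.1 hconj
      refine hA ⟨c, i, k, hk, ?_⟩
      rw [← hc] at hg
      simpa [PresentedGroup.of] using hg.symm
    obtain ⟨u, rfl⟩ := cyclicMk_surjective e u
    have hu0 := hpos u (Commute.refl _) hu
    have hcomm : ∀ {g h}, Commute (cyclicMk e g) (cyclicMk e u) →
        Commute (cyclicMk e h) (cyclicMk e u) → Commute (polyRep x l g) (polyRep x l h) := by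
      intro g h hg hh
      refine commute_of_commute ?_ (commute_polyRep hl hu0 hg) (commute_polyRep hl hu0 hh)
      intro h4
      have := congrArg natDegree h4
      rw [natDegree_pow, natDegree_ofNat] at this
      omega
    -- A nontrivial centralizing element of least trace degree generates: multiplying by `z` or
    -- `z⁻¹` lowers the degree, as in the Euclidean algorithm.
    obtain ⟨z, ⟨hz, hz1⟩, hmin⟩ := exists_minimalFor_of_wellFoundedLT
      (fun g => Commute (cyclicMk e g) (cyclicMk e u) ∧ cyclicMk e g ≠ 1)
      (fun g => (polyRep x l g).val.trace.natDegree) ⟨u, Commute.refl _, hu⟩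
    have main : ∀ n g, (polyRep x l g).val.trace.natDegree = n →
        Commute (cyclicMk e g) (cyclicMk e u) → cyclicMk e g ∈ Subgroup.zpowers (cyclicMk e z) := by
      intro n
      induction n using Nat.strong_induction_on with
      | _ n ih =>
        intro g hn hg
        by_cases hg1 : cyclicMk e g = 1
        · rw [hg1]; exact one_mem _
        have hle : (polyRep x l z).val.trace.natDegree ≤ (polyRep x l g).val.trace.natDegree := by
          by_contra! hlt
          exact absurd (hmin ⟨hg, hg1⟩ hlt.le) (not_le.2 hlt)
        rcases natDegree_trace_le_or_le (hcomm hg hz) (hpos z hz hz1) hle with h | h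
        · rw [← map_mul] at h
          have := ih _ (hn ▸ h) _ rfl (by rw [map_mul]; exact hg.mul_left hz)
          rw [map_mul] at this
          exact (Subgroup.mul_mem_cancel_right _ (Subgroup.mem_zpowers _)).1 this
        · rw [← map_inv, ← map_mul] at h
          have := ih _ (hn ▸ h) _ rfl (by rw [map_mul, map_inv]; exact hg.mul_left hz.inv_left)
          rw [map_mul, map_inv] at this
          exact (Subgroup.mul_mem_cancel_right _ (inv_mem (Subgroup.mem_zpowers _))).1 this
    refine ⟨cyclicMk e z, fun g hg => ?_⟩
    obtain ⟨g, rfl⟩ := cyclicMk_surjective e g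
    exact main _ g rfl hg

theorem mem_zpowers_of_not_isProperPower {H : Type*} [Group H] {u z : H} (hu : ¬ IsProperPower u)
    (h : u ∈ Subgroup.zpowers z) : z ∈ Subgroup.zpowers u := by
  obtain ⟨k, rfl⟩ := h
  simp only at hu ⊢
  have hk : k.natAbs < 2 := by
    by_contra! hk
    rcases Int.natAbs_eq k with h | h
    · exact hu ⟨z, k.natAbs, hk, by conv_rhs => rw [h, zpow_natCast]⟩
    · exact hu ⟨z⁻¹, k.natAbs, hk, by conv_rhs => rw [h, zpow_neg, zpow_natCast, ← inv_pow]⟩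
  have hk0 : k ≠ 0 := by
    rintro rfl
    exact hu ⟨1, 2, le_rfl, by simp⟩
  obtain rfl | rfl : k = 1 ∨ k = -1 := by omega
  · simp
  · simp

theorem mem_zpowers_of_commute [Countable ι] {e : ι → ℕ} {u g : CyclicFreeProduct e}
    (hu : ¬ IsProperPower u) (hg : Commute g u) : g ∈ Subgroup.zpowers u := by
  have hu1 : u ≠ 1 := by
    rintro rfl
    exact hu ⟨1, 2, le_rfl, by simp⟩
  obtain ⟨z, hz⟩ := exists_forall_commute_mem_zpowers hu1
  exact (Subgroup.zpowers_le.2 (mem_zpowers_of_not_isProperPower hu (hz u (Commute.refl u)))) (hz g hg)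

end Centralizers

/-! ### Diagonalization and shared fixed points. -/

section Diagonalization

/-- The diagonal torus of `SL(2, ℂ)`. -/
noncomputable def diagHom : ℂˣ →* SL(2, ℂ) where
  toFun u := ⟨!![(u : ℂ), 0; 0, (u⁻¹ : ℂˣ)], by simp [Matrix.det_fin_two_of]⟩
  map_one' := by ext i j; fin_cases i <;> fin_cases j <;> simp
  map_mul' u v := by
    refine Subtype.ext (Eq.trans (b := !![(u : ℂ), 0; 0, (u⁻¹ : ℂˣ)] * !![(v : ℂ), 0; 0, (v⁻¹ : ℂˣ)])
      ?_ rfl)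
    simp [mul_comm]

theorem diagHom_coe (u : ℂˣ) : (diagHom u).val = !![(u : ℂ), 0; 0, (u⁻¹ : ℂˣ)] := rfl

/-- The rows `(a, b)` and `(c, d)` are left eigenvectors of `M`; rescaling the first gives a
conjugator of determinant one. -/
theorem exists_conj_eq_diagHom_of_eigenvectors {M : SL(2, ℂ)} {u : ℂˣ} {a b c d : ℂ}
    (hdet : a * d - b * c ≠ 0)
    (h1 : a * M.val 0 0 + b * M.val 1 0 = u * a) (h2 : a * M.val 0 1 + b * M.val 1 1 = u * b)
    (h3 : c * M.val 0 0 + d * M.val 1 0 = (u⁻¹ : ℂˣ) * c)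
    (h4 : c * M.val 0 1 + d * M.val 1 1 = (u⁻¹ : ℂˣ) * d) :
    ∃ S : SL(2, ℂ), S * M * S⁻¹ = diagHom u := by
  obtain ⟨S, hS⟩ : ∃ S : SL(2, ℂ),
      S.val = !![(a * d - b * c)⁻¹ * a, (a * d - b * c)⁻¹ * b; c, d] := by
    refine ⟨⟨!![(a * d - b * c)⁻¹ * a, (a * d - b * c)⁻¹ * b; c, d], ?_⟩, rfl⟩
    rw [Matrix.det_fin_two_of]; field_simp
  refine ⟨S, ?_⟩
  rw [mul_inv_eq_iff_eq_mul]
  ext i j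
  rw [Matrix.SpecialLinearGroup.coe_mul, Matrix.SpecialLinearGroup.coe_mul, hS, diagHom_coe]
  generalize (a * d - b * c)⁻¹ = δ
  generalize ((u⁻¹ : ℂˣ) : ℂ) = y at *
  fin_cases i <;> fin_cases j <;> simp [Matrix.mul_apply, Fin.sum_univ_two]
  · linear_combination δ * h1
  · linear_combination δ * h2
  · linear_combination h3
  · linear_combination h4

theorem exists_conj_eq_diagHom {M : SL(2, ℂ)} {u : ℂˣ} (hu : (u : ℂ) ≠ (u⁻¹ : ℂˣ))
    (hM : M.val.trace = u + (u⁻¹ : ℂˣ)) : ∃ S : SL(2, ℂ), S * M * S⁻¹ = diagHom u := by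
  have hd := M.det_coe
  have hui := u.mul_inv
  rw [Matrix.det_fin_two] at hd
  rw [Matrix.trace_fin_two] at hM
  have hu' := sub_ne_zero.2 hu
  by_cases hc : M.val 1 0 = 0
  · rw [hc] at hd
    have hroot : (M.val 0 0 - u) * (M.val 0 0 - (u⁻¹ : ℂˣ)) = 0 := by
      linear_combination M.val 0 0 * hM - hd + hui
    rcases mul_eq_zero.1 hroot with h | h
    · refine exists_conj_eq_diagHom_of_eigenvectors (a := u - (u⁻¹ : ℂˣ)) (b := M.val 0 1) (c := 0)
        (d := 1) (by simpa using hu') ?_ ?_ ?_ ?_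
      · linear_combination (u - (u⁻¹ : ℂˣ)) * h + M.val 0 1 * hc
      · linear_combination M.val 0 1 * (hM - h)
      · linear_combination hc
      · linear_combination hM - h
    · refine exists_conj_eq_diagHom_of_eigenvectors (a := 0) (b := 1) (c := (u⁻¹ : ℂˣ) - u)
        (d := M.val 0 1) (by simpa using hu') ?_ ?_ ?_ ?_
      · linear_combination hc
      · linear_combination hM - h
      · linear_combination ((u⁻¹ : ℂˣ) - u) * h + M.val 0 1 * hc
      · linear_combination M.val 0 1 * (hM - h)
  · refine exists_conj_eq_diagHom_of_eigenvectors (a := M.val 1 0) (b := u - M.val 0 0)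
      (c := M.val 1 0) (d := (u⁻¹ : ℂˣ) - M.val 0 0) ?_ ?_ ?_ ?_ ?_
    · have := mul_ne_zero hc hu'
      contrapose! this
      linear_combination -this
    · ring
    · linear_combination u * hM - hd + hui
    · ring
    · linear_combination (u⁻¹ : ℂˣ) * hM - hd + hui

variable {ι : Type} {e : ι → ℕ}

/-- The conjugate of a representation. -/
def conjRep {H K : Type*} [Group H] [Group K] (S : K) (σ : H →* K) : H →* K :=
  (MulAut.conj S).toMonoidHom.comp σ

@[simp] theorem conjRep_apply {H K : Type*} [Group H] [Group K] (S : K) (σ : H →* K) (g : H) :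
    conjRep S σ g = S * σ g * S⁻¹ := rfl

theorem IsGenericRep.conjRep {σ : FreeGroup ι →* SL(2, ℂ)} (hσ : IsGenericRep e σ) (S : SL(2, ℂ)) :
    IsGenericRep e (conjRep S σ) where
  pow_mem_center i := by
    rw [conjRep_apply, conj_pow]
    have h := hσ.pow_mem_center i
    rwa [Subgroup.mem_center_iff.1 h S, mul_inv_cancel_right]
  trace_sq_ne g hg := by
    rw [conjRep_apply, Matrix.SpecialLinearGroup.coe_mul, Matrix.trace_mul_comm,
      ← Matrix.SpecialLinearGroup.coe_mul, inv_mul_cancel_left]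
    exact hσ.trace_sq_ne g hg

theorem IsGenericRep.coe_ne_one {σ : FreeGroup ι →* SL(2, ℂ)} (hσ : IsGenericRep e σ)
    {g : FreeGroup ι} (hg : cyclicMk e g ≠ 1) : (σ g : PSL(2, ℂ)) ≠ 1 := by
  intro h
  apply hσ.trace_sq_ne g hg
  rw [QuotientGroup.eq_one_iff] at h
  rcases eq_one_or_neg_one_of_mem_center h with h | h <;> rw [h] <;> norm_num

/-- `M` is triangular, so its commutator with a diagonal matrix is unipotent. -/
theorem trace_commutator_diagHom {M : SL(2, ℂ)} (hM : M.val 0 1 * M.val 1 0 = 0) (u : ℂˣ) :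
    (M * diagHom u * M⁻¹ * (diagHom u)⁻¹).val.trace = 2 := by
  have hd := M.det_coe
  have hui := u.mul_inv
  rw [Matrix.det_fin_two] at hd
  rw [← map_inv]
  simp only [Matrix.SpecialLinearGroup.coe_mul, diagHom_coe, Matrix.SpecialLinearGroup.coe_inv,
    Matrix.adjugate_fin_two, Matrix.trace_fin_two, Matrix.mul_apply, Fin.sum_univ_two, inv_inv]
  simp only [Matrix.of_apply, Matrix.cons_val', Matrix.cons_val_zero, Matrix.cons_val_one,
    Matrix.cons_val_fin_one]
  generalize (u : ℂ) = x at *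
  generalize ((u⁻¹ : ℂˣ) : ℂ) = y at *
  linear_combination 2 * hd + 2 * M.val 0 0 * M.val 1 1 * hui + (2 - x ^ 2 - y ^ 2) * hM

/-- Elements outside the cyclic group generated by a hyperbolic `u` share no fixed point with it. -/
theorem IsGenericRep.apply_ne_zero [Countable ι] {σ : FreeGroup ι →* SL(2, ℂ)}
    (hσ : IsGenericRep e σ) {u : FreeGroup ι} {z : ℂˣ} (hu : σ u = diagHom z)
    (hpp : ¬ IsProperPower (cyclicMk e u)) {g : FreeGroup ι}
    (hg : cyclicMk e g ∉ Subgroup.zpowers (cyclicMk e u)) :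
    (σ g).val 0 1 ≠ 0 ∧ (σ g).val 1 0 ≠ 0 := by
  rw [← mul_ne_zero_iff]
  intro h
  have htr := trace_commutator_diagHom h z
  rw [← hu, ← map_inv, ← map_inv, ← map_mul, ← map_mul, ← map_mul] at htr
  have h1 : cyclicMk e (g * u * g⁻¹ * u⁻¹) = 1 := by
    by_contra hne
    exact hσ.trace_sq_ne _ hne (by rw [htr]; norm_num)
  refine hg (mem_zpowers_of_commute hpp ?_)
  rw [commute_iff_eq]
  simpa only [map_mul, map_inv, mul_inv_eq_iff_eq_mul, one_mul] using h1

end Diagonalization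

/-! ### Alternating products in an amalgam. -/

section AlternatingProducts

variable {A B G : Type*} [Group A] [Group B] [Group G]

/-- The product of `i₁ a * i₂ b` over a list of pairs `(a, b)`. -/
def pairProd (i₁ : A →* G) (i₂ : B →* G) (w : List (A × B)) : G :=
  (w.map fun s => i₁ s.1 * i₂ s.2).prod

@[simp] theorem pairProd_nil (i₁ : A →* G) (i₂ : B →* G) : pairProd i₁ i₂ [] = 1 := rfl

@[simp] theorem pairProd_cons (i₁ : A →* G) (i₂ : B →* G) (s : A × B) (w : List (A × B)) :
    pairProd i₁ i₂ (s :: w) = i₁ s.1 * i₂ s.2 * pairProd i₁ i₂ w := by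
  simp [pairProd]

@[simp] theorem pairProd_append (i₁ : A →* G) (i₂ : B →* G) (v w : List (A × B)) :
    pairProd i₁ i₂ (v ++ w) = pairProd i₁ i₂ v * pairProd i₁ i₂ w := by
  simp [pairProd]

theorem map_pairProd {K : Type*} [Group K] (ρ : G →* K) (i₁ : A →* G) (i₂ : B →* G)
    (w : List (A × B)) : ρ (pairProd i₁ i₂ w) = pairProd (ρ.comp i₁) (ρ.comp i₂) w := by
  induction w with
  | nil => simp
  | cons s w ih => simp [ih]

theorem exists_pairProd_eq (i₁ : A →* G) (i₂ : B →* G) (h : i₁.range ⊔ i₂.range = ⊤) (x : G) :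
    ∃ w, pairProd i₁ i₂ w = x := by
  let H : Subgroup G :=
    { carrier := Set.range (pairProd i₁ i₂)
      one_mem' := ⟨[], rfl⟩
      mul_mem' := by
        rintro _ _ ⟨v, rfl⟩ ⟨w, rfl⟩
        exact ⟨v ++ w, by simp⟩
      inv_mem' := by
        rintro _ ⟨w, rfl⟩
        induction w with
        | nil => exact ⟨[], by simp⟩
        | cons s w ih =>
          obtain ⟨v, hv⟩ := ih
          exact ⟨v ++ [(1, s.2⁻¹), (s.1⁻¹, 1)], by simp [hv, mul_assoc]⟩ }
  have : i₁.range ⊔ i₂.range ≤ H := by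
    refine sup_le ?_ ?_
    · rintro _ ⟨a, rfl⟩; exact ⟨[(a, 1)], by simp⟩
    · rintro _ ⟨b, rfl⟩; exact ⟨[(1, b)], by simp⟩
  rw [h] at this
  exact this (Subgroup.mem_top x)

/-- In a group generated by the images of `A` and `B`, every element is conjugate into one of the
images or to an alternating product whose syllables avoid the amalgamated subgroups. -/
theorem isConj_pairProd {i₁ : A →* G} {i₂ : B →* G} (h : i₁.range ⊔ i₂.range = ⊤)
    {C₁ : Subgroup A} {C₂ : Subgroup B} (hC₁ : C₁.map i₁ ≤ i₂.range) (hC₂ : C₂.map i₂ ≤ i₁.range)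
    (x : G) : (∃ a, IsConj (i₁ a) x) ∨ (∃ b, IsConj (i₂ b) x) ∨
      ∃ w ≠ [], (∀ s ∈ w, s.1 ∉ C₁ ∧ s.2 ∉ C₂) ∧ IsConj (pairProd i₁ i₂ w) x := by
  obtain ⟨w, hw, hmin⟩ := exists_minimalFor_of_wellFoundedLT
    (fun w : List (A × B) => IsConj (pairProd i₁ i₂ w) x) List.length
    ((exists_pairProd_eq i₁ i₂ h x).imp fun w hw => by rw [hw])
  have hshort : ∀ v, IsConj (pairProd i₁ i₂ v) (pairProd i₁ i₂ w) → ¬ v.length < w.length := by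
    intro v hv hlt
    exact absurd (hmin (hv.trans hw) hlt.le) (by simpa using hlt)
  by_cases hall : w ≠ [] ∧ ∀ s ∈ w, s.1 ∉ C₁ ∧ s.2 ∉ C₂
  · exact Or.inr (Or.inr ⟨w, hall.1, hall.2, hw⟩)
  rcases eq_or_ne w [] with rfl | hne
  · exact Or.inl ⟨1, by simpa using hw⟩
  have hbad : ∃ s ∈ w, s.1 ∈ C₁ ∨ s.2 ∈ C₂ := by
    by_contra! hcon
    exact hall ⟨hne, hcon⟩
  obtain ⟨⟨a, b⟩, hs, hab⟩ := hbad
  obtain ⟨l, r, rfl⟩ := List.append_of_mem hs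
  -- Rotate the offending pair to the front. Its bad entry can be rewritten in the other factor and
  -- absorbed by a cyclic neighbour, contradicting minimality unless no other pair is left.
  have hrot : IsConj (pairProd i₁ i₂ ((a, b) :: (r ++ l))) (pairProd i₁ i₂ (l ++ (a, b) :: r)) := by
    refine isConj_iff.2 ⟨pairProd i₁ i₂ l, ?_⟩
    simp [mul_assoc]
  have hlen : (l ++ (a, b) :: r).length = (r ++ l).length + 1 := by simp; omega
  generalize r ++ l = t at hrot hlen
  rw [hlen] at hshort
  rcases hab with ha | hb
  · obtain ⟨c, hc⟩ := hC₁ (Subgroup.mem_map_of_mem i₁ ha)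
    rcases t.eq_nil_or_concat with rfl | ⟨t, s, rfl⟩
    · have heq : i₂ (c * b) = pairProd i₁ i₂ [(a, b)] := by simp [hc]
      exact Or.inr (Or.inl ⟨c * b, heq ▸ hrot.trans hw⟩)
    · refine absurd (by simp) (hshort (t ++ [(s.1, s.2 * c * b)])
        (IsConj.trans (isConj_iff.2 ⟨i₂ (c * b), ?_⟩) hrot))
      simp only [List.concat_eq_append, pairProd_append, pairProd_cons, pairProd_nil, map_mul, ← hc]
      group
  · obtain ⟨c, hc⟩ := hC₂ (Subgroup.mem_map_of_mem i₂ hb)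
    rcases t with _ | ⟨s, t⟩
    · have heq : i₁ (a * c) = pairProd i₁ i₂ [(a, b)] := by simp [hc]
      exact Or.inl ⟨a * c, heq ▸ hrot.trans hw⟩
    · have heq : pairProd i₁ i₂ ((a * c * s.1, s.2) :: t) = pairProd i₁ i₂ ((a, b) :: s :: t) := by
        simp [← hc, mul_assoc]
      exact absurd (by simp) (hshort ((a * c * s.1, s.2) :: t) (heq ▸ hrot))

end AlternatingProducts

/-! ### Alternating products under a diagonal twist. -/

section GenericConjugation

/-- The matrix `s ^ 2 • (diag(s, s⁻¹) N diag(s⁻¹, s))` as a polynomial in `s`. -/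
noncomputable def twist (N : SL(2, ℂ)) : Matrix (Fin 2) (Fin 2) ℂ[X] :=
  !![C (N.val 0 0) * X ^ 2, C (N.val 0 1) * X ^ 4; C (N.val 1 0), C (N.val 1 1) * X ^ 2]

theorem hasLead_twist (N : SL(2, ℂ)) : HasLead (twist N) 4 !![0, N.val 0 1; 0, 0] := by
  have hmono (a : ℂ) {n : ℕ} (hn : n ≤ 4) : (C a * X ^ n).natDegree ≤ 4 :=
    (natDegree_C_mul_X_pow_le _ _).trans hn
  have h00 : twist N 0 0 = C (N.val 0 0) * X ^ 2 := rfl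
  have h01 : twist N 0 1 = C (N.val 0 1) * X ^ 4 := rfl
  have h10 : twist N 1 0 = C (N.val 1 0) := rfl
  have h11 : twist N 1 1 = C (N.val 1 1) * X ^ 2 := rfl
  rw [HasLead]
  simp only [Fin.forall_fin_two, h00, h01, h10, h11]
  refine ⟨⟨⟨hmono _ (by norm_num), ?_⟩, hmono _ le_rfl, ?_⟩,
    ⟨(natDegree_C _).le.trans (by norm_num), ?_⟩, hmono _ (by norm_num), ?_⟩ <;>
    simp [coeff_X_pow]

theorem hasLead_map_C (M : Matrix (Fin 2) (Fin 2) ℂ) : HasLead (M.map C) 0 M := by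
  intro i j
  simp

theorem map_eval_twist (N : SL(2, ℂ)) (s : ℂˣ) :
    (twist N).map (evalRingHom (s : ℂ)) =
      (s : ℂ) ^ 2 • (diagHom s * N * (diagHom s)⁻¹).val := by
  have h := s.mul_inv
  rw [← map_inv]
  ext i j
  fin_cases i <;> fin_cases j <;>
    simp only [twist, Matrix.SpecialLinearGroup.coe_mul, diagHom_coe, Matrix.mul_apply,
      Fin.sum_univ_two, Matrix.map_apply, Matrix.smul_apply, inv_inv] <;>
    simp <;> field_simp

/-- The polynomial form of an alternating product. -/
noncomputable def twistProd (w : List (SL(2, ℂ) × SL(2, ℂ))) : Matrix (Fin 2) (Fin 2) ℂ[X] :=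
  (w.map fun s => s.1.val.map C * twist s.2).prod

theorem map_eval_twistProd (w : List (SL(2, ℂ) × SL(2, ℂ))) (s : ℂˣ) :
    (twistProd w).map (evalRingHom (s : ℂ)) = (s : ℂ) ^ (2 * w.length) •
      (pairProd (MonoidHom.id _) (conjRep (diagHom s) (MonoidHom.id _)) w).val := by
  induction w with
  | nil => simp [twistProd, Matrix.map_one]
  | cons a w ih =>
    have : twistProd (a :: w) = a.1.val.map C * twist a.2 * twistProd w := by simp [twistProd]
    rw [this, Matrix.map_mul, Matrix.map_mul, ih, map_eval_twist, Matrix.map_map, pairProd_cons,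
      Matrix.SpecialLinearGroup.coe_mul, Matrix.SpecialLinearGroup.coe_mul, List.length_cons,
      mul_add, pow_add, mul_one]
    have h1 : a.1.val.map (evalRingHom (s : ℂ) ∘ C) = a.1.val := by
      ext i j; simp
    rw [h1]
    simp [smul_smul, mul_comm]

/-- The leading part of each twisted factor is its upper right entry, so each pair multiplies the
bottom row of `L` by `s.1.val 1 0 * s.2.val 0 1`. -/
theorem exists_hasLead_twistProd {w : List (SL(2, ℂ) × SL(2, ℂ))}
    (hw : ∀ s ∈ w, s.1.val 1 0 ≠ 0 ∧ s.2.val 0 1 ≠ 0) :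
    ∃ L, L 1 0 = 0 ∧ L 1 1 ≠ 0 ∧ HasLead (twistProd w) (4 * w.length) L := by
  induction w with
  | nil => exact ⟨1, by simp, by simp, by simpa [twistProd, Matrix.map_one] using hasLead_map_C 1⟩
  | cons a w ih =>
    obtain ⟨L, h0, h1, hL⟩ := ih fun s hs => hw s (List.mem_cons_of_mem _ hs)
    have ha := hw a (by simp)
    have this : twistProd (a :: w) = a.1.val.map C * twist a.2 * twistProd w := by simp [twistProd]
    refine ⟨a.1.val * !![0, a.2.val 0 1; 0, 0] * L, ?_, ?_, ?_⟩
    rotate_left 2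
    · rw [this, List.length_cons, show 4 * (w.length + 1) = 0 + 4 + 4 * w.length by ring]
      exact ((hasLead_map_C _).mul (hasLead_twist _)).mul hL
    · simp [Matrix.mul_apply, Fin.sum_univ_two, h0]
    · simp [Matrix.mul_apply, Fin.sum_univ_two, h1, ha]

/-- With `n` pairs, centrality at `s` gives `(twistProd w 1 1) ^ 2 = X ^ (4 * n)` there; the left
side has degree `8 * n`. -/
theorem finite_pairProd_mem_center {w : List (SL(2, ℂ) × SL(2, ℂ))} (hne : w ≠ [])
    (hw : ∀ s ∈ w, s.1.val 1 0 ≠ 0 ∧ s.2.val 0 1 ≠ 0) :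
    {s : ℂˣ | pairProd (MonoidHom.id _) (conjRep (diagHom s) (MonoidHom.id _)) w ∈
      Subgroup.center SL(2, ℂ)}.Finite := by
  obtain ⟨L, -, h1, hL⟩ := exists_hasLead_twistProd hw
  have hpos : 0 < w.length := List.length_pos_iff.2 hne
  have hdeg : (twistProd w 1 1).natDegree = 4 * w.length :=
    natDegree_eq_of_le_of_coeff_ne_zero (hL 1 1).1 (by rw [(hL 1 1).2]; exact h1)
  have hP : (twistProd w 1 1) ^ 2 - X ^ (4 * w.length) ≠ 0 := by
    intro h0
    have := congrArg natDegree (sub_eq_zero.1 h0)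
    rw [natDegree_pow, natDegree_X_pow, hdeg] at this
    omega
  refine Set.Finite.of_finite_image (f := Units.val) ?_ Units.val_injective.injOn
  refine ((twistProd w 1 1) ^ 2 - X ^ (4 * w.length)).roots.toFinset.finite_toSet.subset ?_
  rintro _ ⟨s, hs, rfl⟩
  have h2 := congrFun (congrFun (map_eval_twistProd w s) 1) 1
  rw [Matrix.map_apply, coe_evalRingHom, Matrix.smul_apply] at h2
  have h3 : (pairProd (MonoidHom.id _) (conjRep (diagHom s) (MonoidHom.id _)) w).val 1 1 ^ 2 = 1 := by
    rcases eq_one_or_neg_one_of_mem_center hs with h | h <;> rw [h] <;> simp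
  simp only [Finset.mem_coe, Multiset.mem_toFinset, mem_roots hP, IsRoot.def, eval_sub, eval_pow,
    eval_X, h2, smul_eq_mul, mul_pow, h3]
  ring

end GenericConjugation

/-! ### Gluing over the amalgamated cyclic subgroup. -/

namespace FTypePresentation

variable (P : FTypePresentation)

/-- The canonical map from the free group on the first block of generators. -/
def freeIncl₁ : FreeGroup (Fin P.p) →* P.Grp := P.incl₁.comp (cyclicMk P.e)

/-- The canonical map from the free group on the second block of generators. -/
def freeIncl₂ : FreeGroup (Fin P.q) →* P.Grp := P.incl₂.comp (cyclicMk P.f)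

theorem freeIncl₁_apply (g : FreeGroup (Fin P.p)) :
    P.freeIncl₁ g = PresentedGroup.mk P.rels (FreeGroup.map Sum.inl g) := rfl

theorem freeIncl₂_apply (g : FreeGroup (Fin P.q)) :
    P.freeIncl₂ g = PresentedGroup.mk P.rels (FreeGroup.map Sum.inr g) := rfl

theorem freeIncl₁_mul_freeIncl₂ :
    P.freeIncl₁ (wordValue P.U) * P.freeIncl₂ (wordValue P.V) = 1 := by
  rw [freeIncl₁_apply, freeIncl₂_apply, ← map_mul]
  exact PresentedGroup.one_of_mem (Or.inr rfl)

theorem range_sup_range : P.freeIncl₁.range ⊔ P.freeIncl₂.range = ⊤ := by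
  rw [eq_top_iff, ← PresentedGroup.closure_range_of, Subgroup.closure_le]
  rintro _ ⟨i | i, rfl⟩
  · exact Subgroup.mem_sup_left ⟨FreeGroup.of i, by rw [freeIncl₁_apply, FreeGroup.map.of]; rfl⟩
  · exact Subgroup.mem_sup_right ⟨FreeGroup.of i, by rw [freeIncl₂_apply, FreeGroup.map.of]; rfl⟩

theorem map_comap_zpowers_le₁ :
    ((Subgroup.zpowers (wordElt P.e P.U)).comap (cyclicMk P.e)).map P.freeIncl₁ ≤
      P.freeIncl₂.range := by
  rintro _ ⟨g, ⟨k, hk⟩, rfl⟩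
  refine ⟨wordValue P.V ^ (-k), ?_⟩
  have h : P.freeIncl₁ g = P.freeIncl₁ (wordValue P.U) ^ k := by
    have := congrArg P.incl₁ hk
    simp only [map_zpow] at this
    exact this.symm
  rw [h, eq_inv_of_mul_eq_one_left P.freeIncl₁_mul_freeIncl₂, map_zpow, inv_zpow, zpow_neg]

theorem map_comap_zpowers_le₂ :
    ((Subgroup.zpowers (wordElt P.f P.V)).comap (cyclicMk P.f)).map P.freeIncl₂ ≤
      P.freeIncl₁.range := by
  rintro _ ⟨g, ⟨k, hk⟩, rfl⟩
  refine ⟨wordValue P.U ^ (-k), ?_⟩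
  have h : P.freeIncl₂ g = P.freeIncl₂ (wordValue P.V) ^ k := by
    have := congrArg P.incl₂ hk
    simp only [map_zpow] at this
    exact this.symm
  rw [h, eq_inv_of_mul_eq_one_right P.freeIncl₁_mul_freeIncl₂, map_zpow, inv_zpow, zpow_neg]

/-- Projective representations of the factors that agree on the amalgamated subgroup extend to the
whole group. -/
theorem exists_rep {σ₁ : FreeGroup (Fin P.p) →* SL(2, ℂ)} {σ₂ : FreeGroup (Fin P.q) →* SL(2, ℂ)}
    (h₁ : IsGenericRep P.e σ₁) (h₂ : IsGenericRep P.f σ₂)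
    (h : σ₁ (wordValue P.U) * σ₂ (wordValue P.V) = 1) :
    ∃ ρ : P.Grp →* PSL(2, ℂ), (∀ g, ρ (P.freeIncl₁ g) = (σ₁ g : PSL(2, ℂ))) ∧
      ∀ g, ρ (P.freeIncl₂ g) = (σ₂ g : PSL(2, ℂ)) := by
  let τ : FreeGroup (Fin P.p ⊕ Fin P.q) →* PSL(2, ℂ) := FreeGroup.lift
    (Sum.elim (fun i => (σ₁ (FreeGroup.of i) : PSL(2, ℂ))) fun j => (σ₂ (FreeGroup.of j) : PSL(2, ℂ)))
  have hτ₁ : ∀ g, τ (FreeGroup.map Sum.inl g) = (σ₁ g : PSL(2, ℂ)) := by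
    have : τ.comp (FreeGroup.map Sum.inl) = (QuotientGroup.mk' _).comp σ₁ := by
      ext i
      simp [τ]
    exact DFunLike.congr_fun this
  have hτ₂ : ∀ g, τ (FreeGroup.map Sum.inr g) = (σ₂ g : PSL(2, ℂ)) := by
    have : τ.comp (FreeGroup.map Sum.inr) = (QuotientGroup.mk' _).comp σ₂ := by
      ext i
      simp [τ]
    exact DFunLike.congr_fun this
  have hrels : ∀ r ∈ P.rels, τ r = 1 := by
    rintro r (⟨i | i, rfl⟩ | rfl)
    · have := hτ₁ (FreeGroup.of i ^ P.e i)
      rw [map_pow, FreeGroup.map.of] at this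
      refine this.trans ?_
      rw [QuotientGroup.eq_one_iff, map_pow]
      exact h₁.pow_mem_center i
    · have := hτ₂ (FreeGroup.of i ^ P.f i)
      rw [map_pow, FreeGroup.map.of] at this
      refine this.trans ?_
      rw [QuotientGroup.eq_one_iff, map_pow]
      exact h₂.pow_mem_center i
    · rw [map_mul, hτ₁, hτ₂, ← QuotientGroup.mk_mul, h, QuotientGroup.mk_one]
  have hmk : ∀ r, PresentedGroup.toGroup hrels (PresentedGroup.mk P.rels r) = τ r := fun r => rfl
  exact ⟨PresentedGroup.toGroup hrels, fun g => by rw [freeIncl₁_apply, hmk, hτ₁],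
    fun g => by rw [freeIncl₂_apply, hmk, hτ₂]⟩

/-- Generic representations of the factors for which `U` and `V` have inverse diagonal images. -/
theorem exists_isGenericRep_diagHom :
    ∃ (u : ℂˣ) (σ₁ : FreeGroup (Fin P.p) →* SL(2, ℂ)) (σ₂ : FreeGroup (Fin P.q) →* SL(2, ℂ)),
      IsGenericRep P.e σ₁ ∧ IsGenericRep P.f σ₂ ∧
      σ₁ (wordValue P.U) = diagHom u ∧ σ₂ (wordValue P.V) = diagHom u⁻¹ := by
  obtain ⟨B₁, hB₁, H₁⟩ := exists_isGenericRep P.U_reduced P.U_infinite_order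
  obtain ⟨B₂, hB₂, H₂⟩ := exists_isGenericRep P.V_reduced P.V_infinite_order
  -- Avoiding `±2` makes the eigenvalues distinct, so both images are diagonalizable.
  obtain ⟨τ, hτ⟩ := exists_notMem_of_countable
    ((hB₁.union hB₂).union (Set.toFinite {2, -2}).countable)
  simp only [Set.mem_union, not_or, Set.mem_insert_iff, Set.mem_singleton_iff] at hτ
  obtain ⟨σ₁, hσ₁, ht₁⟩ := H₁ τ hτ.1.1
  obtain ⟨σ₂, hσ₂, ht₂⟩ := H₂ τ hτ.1.2
  obtain ⟨u, hu⟩ := exists_zpow_add_zpow_inv_eq one_ne_zero τ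
  rw [zpow_one] at hu
  have hne : (u : ℂ) ≠ (u⁻¹ : ℂˣ) := by
    intro h
    have h1 := u.mul_inv
    rw [← h] at h1 hu
    rcases mul_self_eq_one_iff.1 h1 with h2 | h2 <;> rw [h2] at hu
    · exact hτ.2.1 (by rw [← hu]; norm_num)
    · exact hτ.2.2 (by rw [← hu]; norm_num)
  obtain ⟨S₁, hS₁⟩ := exists_conj_eq_diagHom hne (ht₁.trans hu.symm)
  obtain ⟨S₂, hS₂⟩ := exists_conj_eq_diagHom (u := u⁻¹) (by rw [inv_inv]; exact hne.symm)
    (ht₂.trans (by rw [inv_inv, add_comm]; exact hu.symm))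
  exact ⟨u, conjRep S₁ σ₁, conjRep S₂ σ₂, hσ₁.conjRep S₁, hσ₂.conjRep S₂, hS₁, hS₂⟩

variable {P}

theorem injective_comp_incl₁ {ρ : P.Grp →* PSL(2, ℂ)} {σ : FreeGroup (Fin P.p) →* SL(2, ℂ)}
    (hσ : IsGenericRep P.e σ) (h : ∀ g, ρ (P.freeIncl₁ g) = (σ g : PSL(2, ℂ))) :
    Function.Injective (ρ.comp P.incl₁) := by
  rw [injective_iff_map_eq_one]
  intro a ha
  obtain ⟨g, rfl⟩ := cyclicMk_surjective _ a
  by_contra hg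
  exact hσ.coe_ne_one hg ((h g).symm.trans ha)

theorem injective_comp_incl₂ {ρ : P.Grp →* PSL(2, ℂ)} {σ : FreeGroup (Fin P.q) →* SL(2, ℂ)}
    (hσ : IsGenericRep P.f σ) (h : ∀ g, ρ (P.freeIncl₂ g) = (σ g : PSL(2, ℂ))) :
    Function.Injective (ρ.comp P.incl₂) := by
  rw [injective_iff_map_eq_one]
  intro a ha
  obtain ⟨g, rfl⟩ := cyclicMk_surjective _ a
  by_contra hg
  exact hσ.coe_ne_one hg ((h g).symm.trans ha)

variable (P)

theorem exists_injective_on_factors : ∃ ρ : P.Grp →* PSL(2, ℂ),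
    Function.Injective (ρ.comp P.incl₁) ∧ Function.Injective (ρ.comp P.incl₂) := by
  obtain ⟨u, σ₁, σ₂, h₁, h₂, hU, hV⟩ := P.exists_isGenericRep_diagHom
  obtain ⟨ρ, hρ₁, hρ₂⟩ := P.exists_rep h₁ h₂ (by rw [hU, hV, ← map_mul, mul_inv_cancel, map_one])
  exact ⟨ρ, injective_comp_incl₁ h₁ hρ₁, injective_comp_incl₂ h₂ hρ₂⟩

theorem exists_injective (hU : ¬ IsProperPower (wordElt P.e P.U))
    (hV : ¬ IsProperPower (wordElt P.f P.V)) : ∃ ρ : P.Grp →* PSL(2, ℂ), Function.Injective ρ := by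
  obtain ⟨u, σ₁, σ₂, h₁, h₂, hσU, hσV⟩ := P.exists_isGenericRep_diagHom
  set C₁ := (Subgroup.zpowers (wordElt P.e P.U)).comap (cyclicMk P.e) with hC₁
  set C₂ := (Subgroup.zpowers (wordElt P.f P.V)).comap (cyclicMk P.f) with hC₂
  -- Words are taken in the free groups, which are countable, and each gives finitely many bad `s`.
  have hbad : {s : ℂˣ | ∃ w : List (FreeGroup (Fin P.p) × FreeGroup (Fin P.q)), w ≠ [] ∧
      (∀ a ∈ w, a.1 ∉ C₁ ∧ a.2 ∉ C₂) ∧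
      pairProd σ₁ (conjRep (diagHom s) σ₂) w ∈ Subgroup.center SL(2, ℂ)}.Countable := by
    refine (Set.countable_iUnion fun w : List (FreeGroup (Fin P.p) × FreeGroup (Fin P.q)) =>
      Set.countable_iUnion fun hw : w ≠ [] ∧ ∀ a ∈ w, a.1 ∉ C₁ ∧ a.2 ∉ C₂ =>
        (finite_pairProd_mem_center (w := w.map (Prod.map σ₁ σ₂)) ?_ ?_).countable).mono ?_
    · simpa using hw.1
    · intro s hs
      obtain ⟨a, ha, rfl⟩ := List.mem_map.1 hs
      exact ⟨(h₁.apply_ne_zero hσU hU (hw.2 a ha).1).2, (h₂.apply_ne_zero hσV hV (hw.2 a ha).2).1⟩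
    · rintro s ⟨w, hw, hw', hs⟩
      simp only [Set.mem_iUnion]
      refine ⟨w, ⟨hw, hw'⟩, ?_⟩
      have : pairProd (MonoidHom.id _) (conjRep (diagHom s) (MonoidHom.id _))
          (w.map (Prod.map σ₁ σ₂)) = pairProd σ₁ (conjRep (diagHom s) σ₂) w := by
        simp [pairProd, Function.comp_def]
      rwa [Set.mem_ofPred_eq, this]
  obtain ⟨z, hz⟩ := exists_notMem_of_countable
    ((hbad.image Units.val).union (Set.countable_singleton 0))
  simp only [Set.mem_union, Set.mem_singleton_iff, not_or] at hz
  have hs : ∀ w : List (FreeGroup (Fin P.p) × FreeGroup (Fin P.q)), w ≠ [] →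
      (∀ a ∈ w, a.1 ∉ C₁ ∧ a.2 ∉ C₂) →
      pairProd σ₁ (conjRep (diagHom (Units.mk0 z hz.2)) σ₂) w ∉ Subgroup.center SL(2, ℂ) :=
    fun w hw hw' hmem => hz.1 ⟨Units.mk0 z hz.2, ⟨w, hw, hw', hmem⟩, rfl⟩
  generalize Units.mk0 z hz.2 = s at hs
  have h₂' := h₂.conjRep (diagHom s)
  -- The twist fixes the diagonal image of `V`, so the relation `U V = 1` survives.
  obtain ⟨ρ, hρ₁, hρ₂⟩ := P.exists_rep h₁ h₂' (by
    rw [conjRep_apply, hσU, hσV, ← map_inv, ← map_mul, ← map_mul, ← map_mul, mul_inv_cancel_comm,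
      mul_inv_cancel, map_one])
  refine ⟨ρ, (injective_iff_map_eq_one ρ).2 fun x hx => ?_⟩
  have hconj : ∀ {y}, IsConj y x → (ρ y = 1 → y = 1) → x = 1 := by
    intro y hy h
    obtain ⟨c, rfl⟩ := isConj_iff.1 hy
    have : ρ y = 1 := by
      simpa using hx
    rw [h this]
    simp
  rcases isConj_pairProd P.range_sup_range P.map_comap_zpowers_le₁ P.map_comap_zpowers_le₂ x with
    ⟨a, ha⟩ | ⟨b, hb⟩ | ⟨w, hne, hw, hconjw⟩
  · refine hconj ha fun h => ?_
    rw [freeIncl₁, MonoidHom.comp_apply,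
      (injective_iff_map_eq_one _).1 (injective_comp_incl₁ h₁ hρ₁) (cyclicMk P.e a) h,
      map_one]
  · refine hconj hb fun h => ?_
    rw [freeIncl₂, MonoidHom.comp_apply,
      (injective_iff_map_eq_one _).1 (injective_comp_incl₂ h₂' hρ₂) (cyclicMk P.f b) h,
      map_one]
  · refine hconj hconjw fun h => absurd ?_ (hs w hne hw)
    rw [map_pairProd, show ρ.comp P.freeIncl₁ = (QuotientGroup.mk' _).comp σ₁ from
      MonoidHom.ext hρ₁, show ρ.comp P.freeIncl₂ = (QuotientGroup.mk' _).comp _ from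
      MonoidHom.ext hρ₂, ← map_pairProd] at h
    exact (QuotientGroup.eq_one_iff _).1 h

end FTypePresentation

theorem mainTheorem2 (G : Type*) [Group G] (P : FTypePresentation) (φ : P.Grp ≃* G) :
    (∃ ρ : G →* PSL(2, ℂ),
      Function.Injective ((ρ.comp φ.toMonoidHom).comp P.incl₁) ∧
      Function.Injective ((ρ.comp φ.toMonoidHom).comp P.incl₂)) ∧
    (¬ IsProperPower (wordElt P.e P.U) → ¬ IsProperPower (wordElt P.f P.V) →
      ∃ ρ : G →* PSL(2, ℂ), Function.Injective ρ) := by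
  constructor
  · obtain ⟨ρ, h₁, h₂⟩ := P.exists_injective_on_factors
    refine ⟨ρ.comp φ.symm.toMonoidHom, ?_⟩
    have : (ρ.comp φ.symm.toMonoidHom).comp φ.toMonoidHom = ρ := by ext x; simp
    rw [this]
    exact ⟨h₁, h₂⟩
  · intro hU hV
    obtain ⟨ρ, hρ⟩ := P.exists_injective hU hV
    exact ⟨ρ.comp φ.symm.toMonoidHom, hρ.comp φ.symm.injective⟩
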